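/- **Theorem 1 (prediction bound for the denoised IPW-Lasso).** *Setting.* Let $(Y_i,T_i,V_i)_{i\ge 1}$ be i.i.d. with $Y_i$ real, $T_i\in\{0,1\}$ and $V_i$ a covariate in a measurable space. The sample of size $n$ uses the $p=p_n\ge 1$ dimensional regressors $X_i=\varphi_n(V_i)\in\mathbb R^{p}$ with $\varphi_n$ measurable. (The standard case of fixed $p$ and $X_i=V_i\in\mathbb R^p$ is included; $p_n$ may also vary with $n$ and exceed $n$.) Let $p(v)=P(T_i=1\mid V_i=v)$ be the known propensity score, $W_i=\frac{T_i-p(V_i)}{p(V_i)(1-p(V_i))}$, and let $\beta=\beta_n\in\mathbb R^{p}$ satisfy the regression model $Y_iW_i=X_i'\beta+e_i$, $E[e_i\mid V_i]=0$. *Nuisance estimates.* For each $n$, split $\{1,\dots,n\}$ into $K$ disjoint folds $I_1,\dots,I_K$ (for example of equal size), deterministically or at random independently of the data. For each $k$, let $\widehat B_{I_k^c}$ be a function computed measurably from the observations outside $I_k$ and, possibly, randomness independent of the data. *Assumptions.* - (Overlap) For some $\xi>0$, $\xi<p(V_i)<1-\xi$ almost surely. - (Boundedness) For some $C>0$ independent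 of $n$, $|X_{ij}|\le C$ almost surely for all $j\le p$. - (Moment) $E[e_i^2]<\infty$. - ($L_2$ convergence) There is a function $B$ with $E[B(V_i)^2]<\infty$ and, for every $k$, $\lim_{n\to\infty}E\int(\widehat B_{I_k^c}(v)-B(v))^2\,dF(v)=0$, where $F$ is the law of $V_i$. No rate is required. - (Nonsingularity) $\det E[Z_iZ_i']\neq0$, where $Z_i=(W_i,B(V_i)W_i)'$. *Notation.* Put $\gamma=E[Z_iZ_i']^{-1}E[Z_iY_iW_i]$, $Y_i^*=Y_iW_i-Z_i'\gamma$, $u_i=e_i-Z_i'\gamma$, $\sigma_e=\sqrt{E[e_i^2]}$ and $\sigma_u=\sqrt{E[u_i^2]}$. Let $X$, $Z$, $\hat Z$ be the matrices with rows $X_i'$, $Z_i'$, $(W_i,\widehat B_{I_k^c}(V_i)W_i)$ for $i\in I_k$; let $Y^*=(Y_1^*,\dots,Y_n^*)'$, and let $P_{\hat Z}$ be the orthogonal projection onto the column space of $\hat Z$ (equal to $\hat Z(\hat Z'\hat Z)^{-1}\hat Z'$ when $\hat Z'\hat Z$ is invertible). *Estimator.* Let $\widehat Y_i^*$ be the residuals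 of an OLS regression of $Y_iW_i$ on the rows of $\hat Z$, and let $\hat\beta$ be any minimizer of $b\mapsto\frac1{2n}\sum_{i=1}^n(\widehat Y_i^*-X_i'b)^2+\lambda\|b\|_1$. *Claim.* Let $\eta\in(0,1)$ and $\epsilon>0$, and define $$\delta_n=P\left(\left\|\tfrac1nX'(Z-P_{\hat Z}Z)\gamma-\tfrac1nX'P_{\hat Z}Y^*\right\|_\infty\ge\epsilon\sqrt{\tfrac{\log 2p}{n}}\right).$$ 1. For every $n\ge1$ and every $\lambda\ge\left(\frac{\sqrt8\,C\sigma_u}{\eta}+\epsilon\right)\sqrt{\frac{\log 2p}{n}}$, with probability at least $1-\eta-\delta_n$, $$\frac1n\|X\hat\beta-X\beta\|_2^2\le4\lambda\|\beta\|_1 ,$$ simultaneously for all minimizers $\hat\beta$. 2. $\delta_n\to0$ as $n\to\infty$. 3. If $\sigma_u<\sigma_e$, then for all sufficiently small $\epsilon'>0$ one has $\left(\frac{\sqrt8C\sigma_u}{\eta}+\epsilon'\right)\sqrt{\frac{\log2p}{n}}<\frac{\sqrt8C\sigma_e}{\eta}\sqrt{\frac{\log2p}{n}}$. That is, the smallest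 penalty level admitted above is below $\frac{\sqrt8C\sigma_e}{\eta}\sqrt{\frac{\log2p}{n}}$, the corresponding level for the Lasso without denoising. -/

import Mathlib

open MeasureTheory ProbabilityTheory Filter Topology
open scoped ENNReal Matrix

noncomputable section

namespace DIPW

/-! ### Deterministic ingredients: least squares, Lasso, projection -/

/-- `g` is an ordinary least squares coefficient for regressing `y` on the columns of `A`. -/
def IsOLS {n d : ℕ} (A : Matrix (Fin n) (Fin d) ℝ) (y : Fin n → ℝ) (g : Fin d → ℝ) : Prop :=
  ∀ g' : Fin d → ℝ, ∑ i, (y i - (A *ᵥ g) i) ^ 2 ≤ ∑ i, (y i - (A *ᵥ g') i) ^ 2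

/-- The Lasso objective `(1/2n) ‖y - A b‖₂² + lam ‖b‖₁`. -/
def lassoObjective {n d : ℕ} (A : Matrix (Fin n) (Fin d) ℝ) (y : Fin n → ℝ) (lam : ℝ)
    (b : Fin d → ℝ) : ℝ :=
  1 / (2 * (n : ℝ)) * ∑ i, (y i - (A *ᵥ b) i) ^ 2 + lam * ∑ j, |b j|

/-- `b` is a Lasso solution with penalty level `lam` (solutions need not be unique). -/
def IsLasso {n d : ℕ} (A : Matrix (Fin n) (Fin d) ℝ) (y : Fin n → ℝ) (lam : ℝ)
    (b : Fin d → ℝ) : Prop :=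
  ∀ b' : Fin d → ℝ, lassoObjective A y lam b ≤ lassoObjective A y lam b'

/-- `P_A y`: the Euclidean orthogonal projection of `y` onto the column space of `A`.  It is
`A (AᵀA)⁻¹ Aᵀ y` when `AᵀA` is invertible, see `colProj_eq`, and is meaningful without it. -/
def colProj {n d : ℕ} (A : Matrix (Fin n) (Fin d) ℝ) (y : Fin n → ℝ) : Fin n → ℝ :=
  WithLp.ofLp ((LinearMap.range (Matrix.toEuclideanLin A)).starProjection (WithLp.toLp 2 y))

theorem colProj_eq {n d : ℕ} (A : Matrix (Fin n) (Fin d) ℝ) (hA : (Aᵀ * A).det ≠ 0)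
    (y : Fin n → ℝ) : colProj A y = (A * (Aᵀ * A)⁻¹ * Aᵀ) *ᵥ y := by
  have hu : IsUnit (Aᵀ * A).det := isUnit_iff_ne_zero.mpr hA
  have key : (LinearMap.range (Matrix.toEuclideanLin A)).starProjection (WithLp.toLp 2 y)
      = WithLp.toLp 2 ((A * (Aᵀ * A)⁻¹ * Aᵀ) *ᵥ y) := by
    apply Submodule.eq_starProjection_of_mem_of_inner_eq_zero
    · refine ⟨WithLp.toLp 2 (((Aᵀ * A)⁻¹ * Aᵀ) *ᵥ y), ?_⟩
      simp [Matrix.toLpLin_apply, Matrix.mulVec_mulVec, Matrix.mul_assoc]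
    · rintro _ ⟨w, rfl⟩
      have h0 : Aᵀ *ᵥ (y - (A * (Aᵀ * A)⁻¹ * Aᵀ) *ᵥ y) = 0 := by
        rw [Matrix.mulVec_sub, Matrix.mulVec_mulVec, ← Matrix.mul_assoc, ← Matrix.mul_assoc,
          Matrix.mul_nonsing_inv _ hu, Matrix.one_mul, sub_self]
      have h1 : inner ℝ (WithLp.toLp 2 y - WithLp.toLp 2 ((A * (Aᵀ * A)⁻¹ * Aᵀ) *ᵥ y))
          (Matrix.toEuclideanLin A w)
          = (A *ᵥ WithLp.ofLp w) ⬝ᵥ (y - (A * (Aᵀ * A)⁻¹ * Aᵀ) *ᵥ y) := by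
        rw [EuclideanSpace.inner_eq_star_dotProduct]
        simp [Matrix.toLpLin_apply]
      rw [h1, dotProduct_comm, Matrix.dotProduct_mulVec, ← Matrix.mulVec_transpose, h0,
        zero_dotProduct]
  rw [colProj, key]

/-! ### The data, the split and the cross-fitted learner -/

/-- All the objects of the problem: a sequence of observations `(Y i, T i, V i)` with response `Y`,
binary treatment `T` and covariates `V`; for the sample of size `n`, the `p n`-dimensional vector
of regressors `φ n (V i)` (for `𝒱 = ℝᵖ` and `φ n = id` the regressors are the covariates
themselves); the known propensity function `ps`; and the cross-fitted nuisance estimate. The latter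
may use a random seed `S`: `fold n s` splits the sample `{0, …, n-1}` into `K` folds, and
`learner n k s d` is the function of the covariates which the learner returns for the fold `k` from
the observations in `d` outside that fold. -/
structure Setup (Ω 𝒱 𝒮 : Type*) [MeasurableSpace Ω] [MeasurableSpace 𝒱] [MeasurableSpace 𝒮] where
  Y : ℕ → Ω → ℝ
  T : ℕ → Ω → ℝ
  V : ℕ → Ω → 𝒱
  S : Ω → 𝒮
  p : ℕ → ℕ
  φ : (n : ℕ) → 𝒱 → Fin (p n) → ℝ
  ps : 𝒱 → ℝ
  K : ℕ
  fold : (n : ℕ) → 𝒮 → Fin n → Fin K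
  learner : (n : ℕ) → Fin K → 𝒮 → (Fin n → ℝ × ℝ × 𝒱) → 𝒱 → ℝ
  p_pos : ∀ n, 1 ≤ p n
  measurable_Y : ∀ i, Measurable (Y i)
  measurable_T : ∀ i, Measurable (T i)
  measurable_V : ∀ i, Measurable (V i)
  measurable_S : Measurable S
  measurable_φ : ∀ n, Measurable (φ n)
  measurable_ps : Measurable ps
  measurable_fold : ∀ n, Measurable (fold n)
  measurable_learner : ∀ n k, Measurable
    (fun q : 𝒮 × (Fin n → ℝ × ℝ × 𝒱) × 𝒱 => learner n k q.1 q.2.1 q.2.2)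
  T_binary : ∀ i ω, T i ω = 0 ∨ T i ω = 1
  learner_complement : ∀ n k s (d d' : Fin n → ℝ × ℝ × 𝒱),
    (∀ i, fold n s i ≠ k → d i = d' i) → learner n k s d = learner n k s d'

namespace Setup

variable {Ω 𝒱 𝒮 : Type*} [MeasurableSpace Ω] [MeasurableSpace 𝒱] [MeasurableSpace 𝒮]
variable (D : Setup Ω 𝒱 𝒮)

/-- The `i`-th observation. -/
def obs (i : ℕ) (ω : Ω) : ℝ × ℝ × 𝒱 := (D.Y i ω, D.T i ω, D.V i ω)

/-- The observations are i.i.d., and the seed is independent of them. -/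
def RandomSample (μ : Measure Ω) : Prop :=
  iIndepFun D.obs μ ∧ (∀ i, IdentDistrib (D.obs i) (D.obs 0) μ μ) ∧
    IndepFun D.S (fun ω i => D.obs i ω) μ

/-- The σ-algebra generated by the covariates of an observation. -/
abbrev sigmaV : MeasurableSpace Ω := MeasurableSpace.comap (D.V 0) inferInstance

/-- Overlap: `ps` is the propensity function and lies strictly between `ξ` and `1 - ξ`. -/
def Overlap (μ : Measure Ω) (ξ : ℝ) : Prop :=
  0 < ξ ∧ μ[D.T 0 | D.sigmaV] =ᵐ[μ] (fun ω => D.ps (D.V 0 ω)) ∧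
    ∀ᵐ ω ∂μ, ξ < D.ps (D.V 0 ω) ∧ D.ps (D.V 0 ω) < 1 - ξ

/-- The inverse propensity weight `W = (T - p(V)) / (p(V) (1 - p(V)))`. -/
def W (i : ℕ) (ω : Ω) : ℝ :=
  (D.T i ω - D.ps (D.V i ω)) / (D.ps (D.V i ω) * (1 - D.ps (D.V i ω)))

/-- The transformed outcome `Y W`. -/
def YW (i : ℕ) (ω : Ω) : ℝ := D.Y i ω * D.W i ω

/-- The regression model `E[Y W | V] = X'β`, for the regressors `X = φ n V` of each size `n`. -/
def LinearModel (μ : Measure Ω) (β : (n : ℕ) → Fin (D.p n) → ℝ) : Prop :=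
  ∀ n, μ[D.YW 0 | D.sigmaV] =ᵐ[μ] (fun ω => D.φ n (D.V 0 ω) ⬝ᵥ β n)

/-- The regressors are bounded by `C`. -/
def BoundedRegressors (μ : Measure Ω) (C : ℝ) : Prop :=
  0 < C ∧ ∀ n j, ∀ᵐ ω ∂μ, |D.φ n (D.V 0 ω) j| ≤ C

/-- The error `e = Y W - X'β` of the regression model. -/
def e (β : (n : ℕ) → Fin (D.p n) → ℝ) (n i : ℕ) (ω : Ω) : ℝ :=
  D.YW i ω - D.φ n (D.V i ω) ⬝ᵥ β n

/-- The index of the fold that contains the observation `i`, in the sample of size `n`. -/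
def foldOf (n : ℕ) (ω : Ω) (i : Fin n) : Fin D.K := D.fold n (D.S ω) i

/-- The nuisance estimate for the fold `k`, computed from the complement of that fold. -/
def Bhat (n : ℕ) (k : Fin D.K) (ω : Ω) (v : 𝒱) : ℝ :=
  D.learner n k (D.S ω) (fun i => D.obs i ω) v

/-- The nuisance estimates converge in `L²` to the square integrable function `B`:
`E ∫ (B̂(v) - B(v))² dF(v) → 0` for each fold, with `F` the law of `V`. -/
def L2Convergence (μ : Measure Ω) (B : 𝒱 → ℝ) : Prop :=
  Measurable B ∧ MemLp (fun ω => B (D.V 0 ω)) 2 μ ∧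
    ∀ k, Tendsto (fun n => ∫⁻ ω, ∫⁻ v, ENNReal.ofReal ((D.Bhat n k ω v - B v) ^ 2)
      ∂(μ.map (D.V 0)) ∂μ) atTop (𝓝 0)

/-- `Z = (W, B(V) W)'`. -/
def Z (B : 𝒱 → ℝ) (i : ℕ) (ω : Ω) : Fin 2 → ℝ := ![D.W i ω, B (D.V i ω) * D.W i ω]

/-- `E[Z Z']`. -/
def secondMomentZ (μ : Measure Ω) (B : 𝒱 → ℝ) : Matrix (Fin 2) (Fin 2) ℝ :=
  Matrix.of fun a b => ∫ ω, D.Z B 0 ω a * D.Z B 0 ω b ∂μ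

/-- The linear projection coefficients `γ = (α₁, α₂)' = E[Z Z']⁻¹ E[Z Y W]`. -/
def gam (μ : Measure Ω) (B : 𝒱 → ℝ) : Fin 2 → ℝ :=
  (D.secondMomentZ μ B)⁻¹ *ᵥ (fun a => ∫ ω, D.Z B 0 ω a * D.YW 0 ω ∂μ)

/-- `Y* = Y W - Z'γ`. -/
def Ystar (μ : Measure Ω) (B : 𝒱 → ℝ) (i : ℕ) (ω : Ω) : ℝ :=
  D.YW i ω - D.Z B i ω ⬝ᵥ D.gam μ B

/-- The error `u = Y W - X'β - Z'γ = Y W - X'β - α₁ W - α₂ B(V) W` after denoising. -/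
def u (μ : Measure Ω) (B : 𝒱 → ℝ) (β : (n : ℕ) → Fin (D.p n) → ℝ) (n i : ℕ) (ω : Ω) : ℝ :=
  D.e β n i ω - D.Z B i ω ⬝ᵥ D.gam μ B

/-- `σ_e = √E[e²]`. -/
def sigmaE (μ : Measure Ω) (β : (n : ℕ) → Fin (D.p n) → ℝ) (n : ℕ) : ℝ :=
  Real.sqrt (∫ ω, D.e β n 0 ω ^ 2 ∂μ)

/-- `σ_u = √E[u²]`. -/
def sigmaU (μ : Measure Ω) (B : 𝒱 → ℝ) (β : (n : ℕ) → Fin (D.p n) → ℝ) (n : ℕ) : ℝ :=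
  Real.sqrt (∫ ω, D.u μ B β n 0 ω ^ 2 ∂μ)

/-! ### Sample matrices and vectors -/

/-- The `n × p` matrix `X` of regressors. -/
def Xmat (n : ℕ) (ω : Ω) : Matrix (Fin n) (Fin (D.p n)) ℝ :=
  Matrix.of fun i j => D.φ n (D.V i ω) j

/-- The vector of transformed outcomes. -/
def YWvec (n : ℕ) (ω : Ω) : Fin n → ℝ := fun i => D.YW i ω

/-- The `n × 2` matrix `Z`. -/
def Zmat (B : 𝒱 → ℝ) (n : ℕ) (ω : Ω) : Matrix (Fin n) (Fin 2) ℝ :=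
  Matrix.of fun i a => D.Z B i ω a

/-- The `n × 2` matrix `Ẑ` whose `i`-th row is `(W, B̂(V) W)`, where `B̂` was computed without the
fold that contains `i`. -/
def Zhat (n : ℕ) (ω : Ω) : Matrix (Fin n) (Fin 2) ℝ :=
  Matrix.of fun i => ![D.W i ω, D.Bhat n (D.foldOf n ω i) ω (D.V i ω) * D.W i ω]

/-- `b` is a denoised IPW-Lasso estimate: the Lasso applied to the residual `Ŷ*` of a least squares
regression of `Y W` on `Ẑ`. -/
def IsDIPWLasso (n : ℕ) (ω : Ω) (lam : ℝ) (b : Fin (D.p n) → ℝ) : Prop :=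
  ∃ g : Fin 2 → ℝ, IsOLS (D.Zhat n ω) (D.YWvec n ω) g ∧
    IsLasso (D.Xmat n ω) (D.YWvec n ω - D.Zhat n ω *ᵥ g) lam b

/-- The nuisance-estimation term `n⁻¹ X'(Z - P_Ẑ Z)γ - n⁻¹ X' P_Ẑ Y*`. -/
def remainder (μ : Measure Ω) (B : 𝒱 → ℝ) (n : ℕ) (ω : Ω) : Fin (D.p n) → ℝ :=
  (1 / (n : ℝ)) • ((D.Xmat n ω)ᵀ *ᵥ (D.Zmat B n ω *ᵥ D.gam μ B
      - colProj (D.Zhat n ω) (D.Zmat B n ω *ᵥ D.gam μ B)))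
    - (1 / (n : ℝ)) • ((D.Xmat n ω)ᵀ *ᵥ colProj (D.Zhat n ω) (fun i => D.Ystar μ B i ω))

/-- The rate `√(log(2p)/n)`. -/
def rate (n : ℕ) : ℝ := Real.sqrt (Real.log (2 * (D.p n : ℝ)) / (n : ℝ))

/-- `δ_n`: the probability that the sup norm of the nuisance-estimation term is at least
`ε √(log(2p)/n)`. -/
def delta (μ : Measure Ω) (B : 𝒱 → ℝ) (ε : ℝ) (n : ℕ) : ℝ :=
  μ.real {ω | ε * D.rate n ≤ ‖D.remainder μ B n ω‖}

end Setup

end DIPW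

end

/-!
The prediction bound is the slow-rate Lasso inequality. The residuals of the first-stage regression
are `Xβ + u + R` with `n⁻¹ X'R` equal to the nuisance-estimation term, so every minimizer obeys the
bound as soon as the penalty level is at least `‖n⁻¹ X'u‖∞ + ‖n⁻¹ X'R‖∞`
(`IsLasso.prediction_le`, `IsDIPWLasso.prediction_le`).

The score `n⁻¹ X'u` is a mean of independent centered vectors, because both the regression error and
the inverse propensity weight have conditional mean zero given the covariates. Symmetrization and
Massart's inequality for Rademacher averages (`integral_norm_sum_le`) bound its mean sup norm by
`√8 C σ_u √(log(2p)/n)`, and Markov's inequality gives the level in the theorem.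

The nuisance-estimation term is negligible at the rate `r = √(log(2p)/n)`, without any rate for the
nuisance estimates. Write `δ` for the second column of `Ẑ - Z` and `q = γ₁ δ - Y*`, where `γ₁` is
the coefficient of that column. The term equals `n⁻¹ X'(P_Ẑ q) - γ₁ n⁻¹ X'δ`.

* Given the seed and the observations outside a fold, the entries of `δ` in that fold are
  independent and centered, again because of the weight. Hence the maximal inequality applies
  conditionally and bounds the score `n⁻¹ X'δ` by `r` times the `L²` error of the estimates
  (`RandomSample.lintegral_crossfit`, `RandomSample.lintegral_norm_score_nuisanceError_le`).
* `P_Ẑ q = Ẑ g` where `g` is small: the columns of `Ẑ` are asymptotically uncorrelated with `q`, as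
  `δ` is small in empirical norm and `Y*` is the residual of the population regression on `Z`, and
  their Gram matrix is bounded below (`abs_coeff_le`). The scores of the columns of `Ẑ` are of the
  order of `r`, so `n⁻¹ X'Ẑ g` is of smaller order (`norm_remainder_le`,
  `tendsto_measure_remainder`).

The sup norm of `n⁻¹ X'R` is compared with `r` throughout, so the dimension `p` may grow with `n` at
any speed.
-/

noncomputable section

namespace DIPW

/-! ### Projection onto a column space, least squares and the Lasso inequality -/

theorem colProj_add {n d : ℕ} (A : Matrix (Fin n) (Fin d) ℝ) (x y : Fin n → ℝ) :
    colProj A (x + y) = colProj A x + colProj A y := by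
  simp [colProj]

theorem colProj_sub {n d : ℕ} (A : Matrix (Fin n) (Fin d) ℝ) (x y : Fin n → ℝ) :
    colProj A (x - y) = colProj A x - colProj A y := by
  simp [colProj]

theorem colProj_mulVec {n d : ℕ} (A : Matrix (Fin n) (Fin d) ℝ) (g : Fin d → ℝ) :
    colProj A (A *ᵥ g) = A *ᵥ g := by
  have h : WithLp.toLp 2 (A *ᵥ g) ∈ LinearMap.range (Matrix.toEuclideanLin A) :=
    ⟨WithLp.toLp 2 g, by simp [Matrix.toLpLin_apply]⟩
  rw [colProj, Submodule.starProjection_eq_self_iff.mpr h]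

theorem exists_mulVec_eq_colProj {n d : ℕ} (A : Matrix (Fin n) (Fin d) ℝ) (y : Fin n → ℝ) :
    ∃ g, A *ᵥ g = colProj A y := by
  obtain ⟨w, hw⟩ := Submodule.starProjection_apply_mem
    (LinearMap.range (Matrix.toEuclideanLin A)) (WithLp.toLp 2 y)
  refine ⟨WithLp.ofLp w, ?_⟩
  rw [colProj, ← hw]
  simp [Matrix.toLpLin_apply]

/-- The normal equations: the residual of the projection is orthogonal to the column space. -/
theorem mulVec_dotProduct_sub_colProj {n d : ℕ} (A : Matrix (Fin n) (Fin d) ℝ) (y : Fin n → ℝ)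
    (g : Fin d → ℝ) : (A *ᵥ g) ⬝ᵥ (y - colProj A y) = 0 := by
  have h : WithLp.toLp 2 (A *ᵥ g) ∈ LinearMap.range (Matrix.toEuclideanLin A) :=
    ⟨WithLp.toLp 2 g, by simp [Matrix.toLpLin_apply]⟩
  have h1 := Submodule.starProjection_inner_eq_zero (K := LinearMap.range (Matrix.toEuclideanLin A))
    (WithLp.toLp 2 y) _ h
  rw [EuclideanSpace.inner_eq_star_dotProduct] at h1
  simpa [colProj] using h1

theorem IsOLS.mulVec_eq {n d : ℕ} {A : Matrix (Fin n) (Fin d) ℝ} {y : Fin n → ℝ}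
    {g : Fin d → ℝ} (h : IsOLS A y g) : A *ᵥ g = colProj A y := by
  obtain ⟨g₀, hg₀⟩ := exists_mulVec_eq_colProj A y
  have h1 := h g₀
  have h2 := mulVec_dotProduct_sub_colProj A y (g₀ - g)
  rw [← hg₀, Matrix.mulVec_sub] at h2
  rw [← hg₀]
  -- Pythagoras: the sum of squares at `g` exceeds the one at `g₀` by `‖A g₀ - A g‖²`.
  have h3 : ∑ i, (y i - (A *ᵥ g) i) ^ 2
      = ∑ i, (y i - (A *ᵥ g₀) i) ^ 2 + ∑ i, ((A *ᵥ g₀) i - (A *ᵥ g) i) ^ 2 := by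
    have : ∑ i, (y i - (A *ᵥ g) i) ^ 2
      = ∑ i, (y i - (A *ᵥ g₀) i) ^ 2 + ∑ i, ((A *ᵥ g₀) i - (A *ᵥ g) i) ^ 2
        + 2 * ((A *ᵥ g₀ - A *ᵥ g) ⬝ᵥ (y - A *ᵥ g₀)) := by
      simp only [dotProduct, Pi.sub_apply, Finset.mul_sum, ← Finset.sum_add_distrib]
      exact Finset.sum_congr rfl fun i _ => by ring
    rw [this, h2]; ring
  have h4 : ∑ i, ((A *ᵥ g₀) i - (A *ᵥ g) i) ^ 2 = 0 :=
    le_antisymm (by linarith) (Finset.sum_nonneg fun i _ => sq_nonneg _)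
  rw [Finset.sum_eq_zero_iff_of_nonneg fun i _ => sq_nonneg _] at h4
  funext i
  have := h4 i (Finset.mem_univ i)
  nlinarith [pow_eq_zero_iff (two_ne_zero) |>.mp this]

theorem abs_dotProduct_le {d : ℕ} (x b : Fin d → ℝ) : |x ⬝ᵥ b| ≤ ‖x‖ * ∑ j, |b j| := by
  rw [dotProduct, Finset.mul_sum]
  refine (Finset.abs_sum_le_sum_abs _ _).trans (Finset.sum_le_sum fun j _ => ?_)
  rw [abs_mul]
  exact mul_le_mul_of_nonneg_right (norm_le_pi_norm x j) (abs_nonneg _)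

/-- The slow-rate Lasso inequality: the prediction error is at most `4 lam ‖β‖₁` as soon as the
penalty level dominates the noise `n⁻¹ A'w`. -/
theorem IsLasso.prediction_le {n d : ℕ} (hn : 0 < n) {A : Matrix (Fin n) (Fin d) ℝ}
    {w : Fin n → ℝ} {β b : Fin d → ℝ} {lam : ℝ} (h : IsLasso A (A *ᵥ β + w) lam b)
    (hw : ‖(1 / (n : ℝ)) • (Aᵀ *ᵥ w)‖ ≤ lam) :
    1 / (n : ℝ) * ∑ i, ((A *ᵥ b) i - (A *ᵥ β) i) ^ 2 ≤ 4 * lam * ∑ j, |β j| := by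
  have hn' : (0 : ℝ) < n := by exact_mod_cast hn
  have h1 := h β
  simp only [lassoObjective, Pi.add_apply, add_sub_cancel_left] at h1
  have h2 : ∑ i, ((A *ᵥ β) i + w i - (A *ᵥ b) i) ^ 2
      = ∑ i, ((A *ᵥ b) i - (A *ᵥ β) i) ^ 2 - 2 * (w ⬝ᵥ (A *ᵥ (b - β))) + ∑ i, w i ^ 2 := by
    rw [Matrix.mulVec_sub]
    simp only [dotProduct, Pi.sub_apply, Finset.mul_sum, ← Finset.sum_add_distrib,
      ← Finset.sum_sub_distrib]
    exact Finset.sum_congr rfl fun i _ => by ring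
  have h3 : (1 / (n : ℝ)) * (w ⬝ᵥ (A *ᵥ (b - β))) ≤ lam * (∑ j, |b j| + ∑ j, |β j|) := by
    have e1 : (1 / (n : ℝ)) * (w ⬝ᵥ (A *ᵥ (b - β)))
        = ((1 / (n : ℝ)) • (Aᵀ *ᵥ w)) ⬝ᵥ (b - β) := by
      rw [smul_dotProduct, Matrix.dotProduct_mulVec, ← Matrix.mulVec_transpose, smul_eq_mul]
    rw [e1]
    refine (le_abs_self _).trans ((abs_dotProduct_le _ _).trans ?_)
    refine mul_le_mul hw ?_ (Finset.sum_nonneg fun _ _ => abs_nonneg _)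
      ((norm_nonneg _).trans hw)
    rw [← Finset.sum_add_distrib]
    exact Finset.sum_le_sum fun j _ => abs_sub _ _
  rw [h2] at h1
  have h4 : 1 / (2 * (n : ℝ)) = 1 / (n : ℝ) / 2 := by field_simp
  rw [h4] at h1
  nlinarith

/-- If `n⁻¹ Z'Z ≥ c`, if the second column of `Z` is perturbed by `δ` with `n⁻¹ ‖δ‖² ≤ c / 4`, and
if the perturbed columns are almost uncorrelated with `q`, then the coefficients of the projection
of `q` onto the perturbed columns are small. -/
theorem abs_coeff_le {n : ℕ} {A A' : Matrix (Fin n) (Fin 2) ℝ} {q δ : Fin n → ℝ}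
    {g : Fin 2 → ℝ} {c t : ℝ} (hc : 0 < c) (ht : 0 ≤ t)
    (h0 : ∀ i, A' i 0 = A i 0) (h1 : ∀ i, A' i 1 = A i 1 + δ i)
    (hA : c * (g 0 ^ 2 + g 1 ^ 2) ≤ 1 / (n : ℝ) * ∑ i, (A *ᵥ g) i ^ 2)
    (hδ : 1 / (n : ℝ) * ∑ i, δ i ^ 2 ≤ c / 4)
    (hq : ∀ a, |1 / (n : ℝ) * ∑ i, A' i a * q i| ≤ t)
    (hg : A' *ᵥ g = colProj A' q) :
    |g 0| + |g 1| ≤ 8 * t / c := by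
  have hn : (0 : ℝ) ≤ 1 / (n : ℝ) := by positivity
  have e1 : ∑ i, (A' *ᵥ g) i ^ 2 = g 0 * ∑ i, A' i 0 * q i + g 1 * ∑ i, A' i 1 * q i := by
    have := mulVec_dotProduct_sub_colProj A' q g
    rw [← hg, dotProduct_sub] at this
    have e2 : (A' *ᵥ g) ⬝ᵥ q = g 0 * ∑ i, A' i 0 * q i + g 1 * ∑ i, A' i 1 * q i := by
      simp only [dotProduct, Matrix.mulVec, Fin.sum_univ_two, Finset.mul_sum,
        ← Finset.sum_add_distrib]
      exact Finset.sum_congr rfl fun i _ => by ring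
    rw [← e2, sub_eq_zero.mp this]
    simp only [dotProduct, sq]
  have e2 : ∑ i, (A *ᵥ g) i ^ 2 ≤ 2 * ∑ i, (A' *ᵥ g) i ^ 2 + 2 * g 1 ^ 2 * ∑ i, δ i ^ 2 := by
    rw [Finset.mul_sum, Finset.mul_sum, ← Finset.sum_add_distrib]
    refine Finset.sum_le_sum fun i _ => ?_
    have : (A' *ᵥ g) i = (A *ᵥ g) i + g 1 * δ i := by
      simp only [Matrix.mulVec, dotProduct, Fin.sum_univ_two, h0, h1]; ring
    rw [this]
    nlinarith [sq_nonneg ((A *ᵥ g) i + 2 * (g 1 * δ i))]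
  have e3 := mul_le_mul_of_nonneg_left e2 hn
  rw [e1] at e3
  have e4 : g 0 * (1 / (n : ℝ) * ∑ i, A' i 0 * q i) ≤ |g 0| * t :=
    (le_abs_self _).trans (by rw [abs_mul]; exact mul_le_mul_of_nonneg_left (hq 0) (abs_nonneg _))
  have e5 : g 1 * (1 / (n : ℝ) * ∑ i, A' i 1 * q i) ≤ |g 1| * t :=
    (le_abs_self _).trans (by rw [abs_mul]; exact mul_le_mul_of_nonneg_left (hq 1) (abs_nonneg _))
  have e6 : g 1 ^ 2 * (1 / (n : ℝ) * ∑ i, δ i ^ 2) ≤ g 1 ^ 2 * (c / 4) :=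
    mul_le_mul_of_nonneg_left hδ (sq_nonneg _)
  have e7 : c * (g 0 ^ 2 + g 1 ^ 2) ≤ 4 * (|g 0| + |g 1|) * t := by nlinarith [sq_nonneg (g 0)]
  have e8 : (|g 0| + |g 1|) ^ 2 ≤ 2 * (g 0 ^ 2 + g 1 ^ 2) := by
    nlinarith [sq_nonneg (|g 0| - |g 1|), sq_abs (g 0), sq_abs (g 1)]
  rw [le_div_iff₀ hc]
  by_contra hcon
  push Not at hcon
  have hpos : 0 < |g 0| + |g 1| := by
    by_contra hz
    have : |g 0| + |g 1| = 0 := le_antisymm (not_lt.mp hz) (by positivity)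
    rw [this] at hcon
    linarith
  nlinarith [mul_lt_mul_of_pos_left hcon hpos]

/-- The smallest eigenvalue of a positive semidefinite `2 × 2` matrix is at least the quotient of
its determinant and its trace. -/
theorem det_mul_le_trace_mul (a b d x y : ℝ) :
    (a * d - b ^ 2) * (x ^ 2 + y ^ 2) ≤ (a + d) * (a * x ^ 2 + 2 * b * x * y + d * y ^ 2) := by
  nlinarith [sq_nonneg (a * x + b * y), sq_nonneg (b * x + d * y)]

theorem abs_avg_mul_le {n : ℕ} {x y : Fin n → ℝ} {a b : ℝ} (ha : 0 ≤ a) (hb : 0 ≤ b)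
    (hx : 1 / (n : ℝ) * ∑ i, x i ^ 2 ≤ a ^ 2) (hy : 1 / (n : ℝ) * ∑ i, y i ^ 2 ≤ b ^ 2) :
    |1 / (n : ℝ) * ∑ i, x i * y i| ≤ a * b := by
  refine abs_le_of_sq_le_sq ?_ (mul_nonneg ha hb)
  have hn : (0 : ℝ) ≤ 1 / (n : ℝ) := by positivity
  calc (1 / (n : ℝ) * ∑ i, x i * y i) ^ 2
      = (1 / (n : ℝ)) ^ 2 * (∑ i, x i * y i) ^ 2 := by ring
    _ ≤ (1 / (n : ℝ)) ^ 2 * ((∑ i, x i ^ 2) * ∑ i, y i ^ 2) :=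
        mul_le_mul_of_nonneg_left (Finset.sum_mul_sq_le_sq_mul_sq _ _ _) (sq_nonneg _)
    _ = (1 / (n : ℝ) * ∑ i, x i ^ 2) * (1 / (n : ℝ) * ∑ i, y i ^ 2) := by ring
    _ ≤ a ^ 2 * b ^ 2 := mul_le_mul hx hy
        (mul_nonneg hn (Finset.sum_nonneg fun _ _ => sq_nonneg _)) (sq_nonneg _)
    _ = (a * b) ^ 2 := by ring

/-! ### The maximal inequality for Rademacher averages -/

/-- A sign, encoded by a Boolean. -/
def sgn (b : Bool) : ℝ := if b then 1 else -1

theorem exp_mul_norm_le {κ : Type*} [Fintype κ] [Nonempty κ] {t : ℝ} (x : κ → ℝ) :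
    Real.exp (t * ‖x‖) ≤ ∑ j, (Real.exp (t * x j) + Real.exp (-(t * x j))) := by
  obtain ⟨j, hj⟩ : ∃ j, ‖x‖ = |x j| := by
    obtain ⟨j, -, hj⟩ := Finset.exists_max_image Finset.univ (fun j => |x j|)
      Finset.univ_nonempty
    refine ⟨j, le_antisymm ((pi_norm_le_iff_of_nonneg (abs_nonneg _)).mpr
      fun k => hj k (Finset.mem_univ k)) (norm_le_pi_norm x j)⟩
  have h1 : Real.exp (t * ‖x‖) ≤ Real.exp (t * x j) + Real.exp (-(t * x j)) := by
    rw [hj]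
    rcases abs_cases (x j) with ⟨h, -⟩ | ⟨h, -⟩ <;> rw [h]
    · exact le_add_of_nonneg_right (Real.exp_pos _).le
    · rw [mul_neg]
      exact le_add_of_nonneg_left (Real.exp_pos _).le
  exact h1.trans (Finset.single_le_sum
    (f := fun j => Real.exp (t * x j) + Real.exp (-(t * x j))) (fun _ _ => by positivity)
    (Finset.mem_univ j))

theorem sum_exp_sgn_le {ι : Type*} [Fintype ι] [DecidableEq ι] (a : ι → ℝ) :
    ∑ σ : ι → Bool, Real.exp (∑ i, sgn (σ i) * a i)
      ≤ 2 ^ Fintype.card ι * Real.exp ((∑ i, a i ^ 2) / 2) := by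
  have h1 : ∑ σ : ι → Bool, Real.exp (∑ i, sgn (σ i) * a i) = ∏ i, (2 * Real.cosh (a i)) := by
    have h2 : ∀ i, 2 * Real.cosh (a i) = ∑ b : Bool, Real.exp (sgn b * a i) := by
      intro i
      rw [Real.cosh_eq]
      simp [sgn]
      ring
    simp only [h2, Real.exp_sum, Fintype.prod_sum]
  rw [h1, Finset.prod_mul_distrib, Finset.prod_const, Finset.card_univ, Finset.sum_div,
    Real.exp_sum]
  exact mul_le_mul_of_nonneg_left (Finset.prod_le_prod (fun i _ => (Real.cosh_pos _).le)
    fun i _ => Real.cosh_le_exp_half_sq _) (by positivity)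

/-- Massart's finite class inequality: the mean sup norm over all choices of signs. -/
theorem sum_norm_sgn_le {ι κ : Type*} [Fintype ι] [DecidableEq ι] [Fintype κ] [Nonempty κ]
    (a : ι → κ → ℝ) :
    ((2 : ℝ) ^ Fintype.card ι)⁻¹ * ∑ σ : ι → Bool, ‖∑ i, sgn (σ i) • a i‖
      ≤ Real.sqrt (2 * Real.log (2 * Fintype.card κ)) * Real.sqrt (∑ i, ‖a i‖ ^ 2) := by
  set v := ∑ i, ‖a i‖ ^ 2 with hv
  set l := Real.log (2 * Fintype.card κ) with hl
  set m := ((2 : ℝ) ^ Fintype.card ι)⁻¹ * ∑ σ : ι → Bool, ‖∑ i, sgn (σ i) • a i‖ with hm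
  have hκ : (1 : ℝ) ≤ Fintype.card κ := by exact_mod_cast Fintype.card_pos
  have hl0 : 0 < l := Real.log_pos (by linarith)
  have hN : (0 : ℝ) < 2 ^ Fintype.card ι := by positivity
  have hv0 : 0 ≤ v := Finset.sum_nonneg fun _ _ => sq_nonneg _
  rcases hv0.eq_or_lt with h0 | hv0
  · have ha : ∀ i, a i = 0 := fun i => by
      have := (Finset.sum_eq_zero_iff_of_nonneg fun i _ => sq_nonneg ‖a i‖).mp h0.symm i
        (Finset.mem_univ i)
      simpa using this
    rw [hm]
    simp only [ha, smul_zero, Finset.sum_const_zero, norm_zero, mul_zero]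
    positivity
  -- The Laplace transform bound, for every `t`.
  have key : ∀ t : ℝ, t * m ≤ l + t ^ 2 * v / 2 := by
    intro t
    rw [← Real.exp_le_exp]
    have hj : Real.exp (t * m) ≤ ((2 : ℝ) ^ Fintype.card ι)⁻¹ *
        ∑ σ : ι → Bool, Real.exp (t * ‖∑ i, sgn (σ i) • a i‖) := by
      have := convexOn_exp.map_sum_le (t := (Finset.univ : Finset (ι → Bool)))
        (w := fun _ => ((2 : ℝ) ^ Fintype.card ι)⁻¹)
        (p := fun σ => t * ‖∑ i, sgn (σ i) • a i‖) (fun _ _ => by positivity)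
        (by simp) (fun _ _ => Set.mem_univ _)
      simp only [smul_eq_mul, ← Finset.mul_sum] at this
      calc Real.exp (t * m) = Real.exp (((2 : ℝ) ^ Fintype.card ι)⁻¹ *
            (t * ∑ σ : ι → Bool, ‖∑ i, sgn (σ i) • a i‖)) := by rw [hm]; ring_nf
        _ ≤ _ := this
    refine hj.trans ?_
    rw [inv_mul_le_iff₀ hN]
    have hone : ∀ (s : ℝ) (j : κ), s ^ 2 = t ^ 2 →
        ∑ σ : ι → Bool, Real.exp (s * (∑ i, sgn (σ i) • a i) j)
          ≤ 2 ^ Fintype.card ι * Real.exp (t ^ 2 * v / 2) := by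
      intro s j hs
      have e1 : ∀ σ : ι → Bool, s * (∑ i, sgn (σ i) • a i) j
          = ∑ i, sgn (σ i) * (s * a i j) := by
        intro σ
        simp only [Finset.sum_apply, Pi.smul_apply, smul_eq_mul, Finset.mul_sum]
        exact Finset.sum_congr rfl fun i _ => by ring
      simp only [e1]
      refine (sum_exp_sgn_le _).trans (mul_le_mul_of_nonneg_left ?_ hN.le)
      rw [Real.exp_le_exp, hv, Finset.mul_sum]
      refine div_le_div_of_nonneg_right (Finset.sum_le_sum fun i _ => ?_) two_pos.le
      rw [mul_pow, hs]
      exact mul_le_mul_of_nonneg_left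
        (sq_le_sq' (neg_le_of_abs_le (norm_le_pi_norm (a i) j))
          (le_of_abs_le (norm_le_pi_norm (a i) j))) (sq_nonneg _)
    calc ∑ σ : ι → Bool, Real.exp (t * ‖∑ i, sgn (σ i) • a i‖)
        ≤ ∑ σ : ι → Bool, ∑ j, (Real.exp (t * (∑ i, sgn (σ i) • a i) j)
            + Real.exp (-(t * (∑ i, sgn (σ i) • a i) j))) :=
          Finset.sum_le_sum fun σ _ => exp_mul_norm_le _
      _ = ∑ j, (∑ σ : ι → Bool, Real.exp (t * (∑ i, sgn (σ i) • a i) j)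
            + ∑ σ : ι → Bool, Real.exp (-t * (∑ i, sgn (σ i) • a i) j)) := by
          rw [Finset.sum_comm]
          simp only [Finset.sum_add_distrib, neg_mul]
      _ ≤ ∑ _j : κ, (2 ^ Fintype.card ι * Real.exp (t ^ 2 * v / 2)
            + 2 ^ Fintype.card ι * Real.exp (t ^ 2 * v / 2)) :=
          Finset.sum_le_sum fun j _ => add_le_add (hone t j rfl) (hone (-t) j (neg_sq t))
      _ = 2 ^ Fintype.card ι * Real.exp (l + t ^ 2 * v / 2) := by
          rw [Real.exp_add, hl, Real.exp_log (by linarith), Finset.sum_const, Finset.card_univ,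
            nsmul_eq_mul]
          ring
  -- The optimal choice of `t`.
  have h2l : 0 < Real.sqrt (2 * l) := Real.sqrt_pos.mpr (by linarith)
  have hsv : 0 < Real.sqrt v := Real.sqrt_pos.mpr hv0
  have hk := key (Real.sqrt (2 * l) / Real.sqrt v)
  rw [div_pow, Real.sq_sqrt (by linarith), Real.sq_sqrt hv0.le, div_mul_cancel₀ _ hv0.ne'] at hk
  have hk2 : Real.sqrt (2 * l) * m ≤ 2 * l * Real.sqrt v := by
    rw [div_mul_eq_mul_div, div_le_iff₀ hsv] at hk
    linarith
  have hs := Real.mul_self_sqrt (show 0 ≤ 2 * l by linarith)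
  refine le_of_mul_le_mul_left ?_ h2l
  calc _ ≤ 2 * l * Real.sqrt v := hk2
    _ = _ := by rw [← mul_assoc, hs]

/-! ### Decoupling and the maximal inequality on a product space -/

/-- The point with the coordinates of `d'` in `I` and those of `d` outside `I`. -/
def glue {ι E : Type*} [DecidableEq ι] (I : Finset ι) (d d' : ι → E) : ι → E :=
  fun i => if i ∈ I then d' i else d i

theorem measurable_glue {ι E : Type*} [DecidableEq ι] [MeasurableSpace E] (I : Finset ι) :
    Measurable fun q : (ι → E) × (ι → E) => glue I q.1 q.2 := by
  refine measurable_pi_lambda _ fun i => ?_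
  by_cases h : i ∈ I
  · simp only [glue, h, if_true]; fun_prop
  · simp only [glue, h, if_false]; fun_prop

theorem measurePreserving_coord {ι E : Type*} [Fintype ι] [MeasurableSpace E] (ν : Measure E)
    [IsProbabilityMeasure ν] (i : ι) :
    MeasurePreserving (fun d : ι → E => d i) (Measure.pi fun _ => ν) ν :=
  measurePreserving_eval (fun _ => ν) i

section Product

variable {ι E : Type*} [Fintype ι] [DecidableEq ι] [MeasurableSpace E]

/-- Replacing some coordinates by those of an independent copy does not change the law. -/
theorem measurePreserving_glue (ν : Measure E) [IsProbabilityMeasure ν] (I : Finset ι) :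
    MeasurePreserving (fun q : (ι → E) × (ι → E) => glue I q.1 q.2)
      ((Measure.pi fun _ => ν).prod (Measure.pi fun _ => ν)) (Measure.pi fun _ => ν) := by
  refine ⟨measurable_glue I, (Measure.pi_eq fun s hs => ?_).symm⟩
  rw [Measure.map_apply (measurable_glue I) (MeasurableSet.univ_pi hs)]
  have : (fun q : (ι → E) × (ι → E) => glue I q.1 q.2) ⁻¹' Set.univ.pi s
      = (Set.univ.pi fun i => if i ∈ I then Set.univ else s i) ×ˢ
        (Set.univ.pi fun i => if i ∈ I then s i else Set.univ) := by
    ext ⟨d, d'⟩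
    simp only [glue, Set.mem_preimage, Set.mem_pi, Set.mem_univ, true_imp_iff, Set.mem_prod,
      ← forall_and]
    refine forall_congr' fun i => ?_
    by_cases h : i ∈ I <;> simp [h]
  rw [this, Measure.prod_prod, Measure.pi_pi, Measure.pi_pi, ← Finset.prod_mul_distrib]
  refine Finset.prod_congr rfl fun i _ => ?_
  by_cases h : i ∈ I <;> simp [h]

/-- Decoupling: if `Ψ d d'` depends only on the coordinates of `d` outside `I` and on those of `d'`
inside `I`, then the two arguments may be taken independent. -/
theorem lintegral_diag_eq (ν : Measure E) [IsProbabilityMeasure ν] (I : Finset ι)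
    {Ψ : (ι → E) → (ι → E) → ℝ≥0∞} (hΨ : Measurable fun q : (ι → E) × (ι → E) => Ψ q.1 q.2)
    (h : ∀ d d', Ψ (glue I d d') (glue I d d') = Ψ d d') :
    ∫⁻ d, Ψ d d ∂(Measure.pi fun _ => ν)
      = ∫⁻ d, ∫⁻ d', Ψ d d' ∂(Measure.pi fun _ => ν) ∂(Measure.pi fun _ => ν) := by
  have h1 : Measurable fun d : ι → E => Ψ d d :=
    hΨ.comp (measurable_id.prodMk measurable_id)
  have h2 := lintegral_prod (μ := Measure.pi fun _ : ι => ν) (ν := Measure.pi fun _ : ι => ν)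
    (fun q : (ι → E) × (ι → E) => Ψ (glue I q.1 q.2) (glue I q.1 q.2))
    (h1.comp (measurable_glue I)).aemeasurable
  rw [← (measurePreserving_glue ν I).lintegral_comp h1, h2]
  simp only [h]

variable {G : Type*} [NormedAddCommGroup G] [NormedSpace ℝ G] [CompleteSpace G]

/-- Jensen's inequality: omitting independent centered terms from a sum decreases the mean norm. -/
theorem integral_norm_sum_subset_le (ν : Measure E) [IsProbabilityMeasure ν] {f : ι → E → G}
    (hf : ∀ i, Integrable (f i) ν) (h0 : ∀ i, ∫ x, f i x ∂ν = 0) (J : Finset ι) :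
    ∫ d, ‖∑ i ∈ J, f i (d i)‖ ∂(Measure.pi fun _ => ν)
      ≤ ∫ d, ‖∑ i, f i (d i)‖ ∂(Measure.pi fun _ => ν) := by
  set P : Measure (ι → E) := Measure.pi fun _ => ν with hP
  have hfi : ∀ i, Integrable (fun d : ι → E => f i (d i)) P := fun i =>
    (measurePreserving_coord ν i).integrable_comp_of_integrable (hf i)
  have hsum : ∀ J : Finset ι, Integrable (fun d : ι → E => ∑ i ∈ J, f i (d i)) P := fun J =>
    integrable_finsetSum _ fun i _ => hfi i
  have hmp := measurePreserving_glue ν Jᶜ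
  have hg : Integrable (fun q : (ι → E) × (ι → E) => ∑ i, f i (glue Jᶜ q.1 q.2 i)) (P.prod P) :=
    hmp.integrable_comp_of_integrable (hsum Finset.univ)
  have e1 : ∫ d, ‖∑ i, f i (d i)‖ ∂P
      = ∫ q, ‖∑ i, f i (glue Jᶜ q.1 q.2 i)‖ ∂(P.prod P) := by
    have h1 : AEStronglyMeasurable (fun d : ι → E => ‖∑ i, f i (d i)‖)
        (Measure.map (fun q : (ι → E) × (ι → E) => glue Jᶜ q.1 q.2) (P.prod P)) := by
      rw [hmp.map_eq]
      exact (hsum Finset.univ).norm.aestronglyMeasurable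
    have := integral_map hmp.measurable.aemeasurable h1
    rwa [hmp.map_eq] at this
  rw [e1, integral_prod _ hg.norm]
  refine integral_mono (hsum J).norm hg.norm.integral_prod_left fun d => ?_
  have e2 : ∀ d', ∑ i, f i (glue Jᶜ d d' i) = ∑ i ∈ J, f i (d i) + ∑ i ∈ Jᶜ, f i (d' i) := by
    intro d'
    rw [← Finset.sum_add_sum_compl J]
    congr 1
    · exact Finset.sum_congr rfl fun i hi => by simp [glue, hi]
    · exact Finset.sum_congr rfl fun i hi => by
        have := Finset.mem_compl.mp hi
        simp [glue, this]
  simp only [e2]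
  have e3 : ∫ d', (∑ i ∈ J, f i (d i) + ∑ i ∈ Jᶜ, f i (d' i)) ∂P = ∑ i ∈ J, f i (d i) := by
    rw [integral_add (integrable_const _) (hsum _), integral_finsetSum _ fun i _ => hfi i]
    have : ∀ i, ∫ d', f i (d' i) ∂P = 0 := fun i => by
      have hmi := measurePreserving_coord (ι := ι) ν i
      have h2 := integral_map (f := f i) hmi.measurable.aemeasurable
        (by rw [hmi.map_eq]; exact (hf i).aestronglyMeasurable)
      rw [hmi.map_eq, h0] at h2
      exact h2.symm
    simp [this]
  calc ‖∑ i ∈ J, f i (d i)‖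
      = ‖∫ d', (∑ i ∈ J, f i (d i) + ∑ i ∈ Jᶜ, f i (d' i)) ∂P‖ := by rw [e3]
    _ ≤ _ := norm_integral_le_integral_norm _

/-- Symmetrization. Both the terms with sign `+` and the terms with sign `-` are dominated by the
signed sum, so the bound holds for each choice of signs and needs no independent copy. -/
theorem integral_norm_sum_le_two_mul (ν : Measure E) [IsProbabilityMeasure ν] {f : ι → E → G}
    (hf : ∀ i, Integrable (f i) ν) (h0 : ∀ i, ∫ x, f i x ∂ν = 0) (σ : ι → Bool) :
    ∫ d, ‖∑ i, f i (d i)‖ ∂(Measure.pi fun _ => ν)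
      ≤ 2 * ∫ d, ‖∑ i, sgn (σ i) • f i (d i)‖ ∂(Measure.pi fun _ => ν) := by
  set P : Measure (ι → E) := Measure.pi fun _ => ν with hP
  have hfi : ∀ i, Integrable (fun d : ι → E => f i (d i)) P := fun i =>
    (measurePreserving_coord ν i).integrable_comp_of_integrable (hf i)
  have hsum : ∀ J : Finset ι, Integrable (fun d : ι → E => ∑ i ∈ J, f i (d i)) P := fun J =>
    integrable_finsetSum _ fun i _ => hfi i
  set J : Finset ι := Finset.univ.filter fun i => σ i = true with hJ
  have hsub : ∀ J : Finset ι, ∫ d, ‖∑ i ∈ J, sgn (σ i) • f i (d i)‖ ∂P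
      ≤ ∫ d, ‖∑ i, sgn (σ i) • f i (d i)‖ ∂P := fun J =>
    integral_norm_sum_subset_le ν (f := fun i x => sgn (σ i) • f i x)
      (fun i => (hf i).smul _) (fun i => by rw [integral_smul, h0, smul_zero]) J
  have h1 : ∀ d : ι → E, ∑ i ∈ J, sgn (σ i) • f i (d i) = ∑ i ∈ J, f i (d i) := fun d =>
    Finset.sum_congr rfl fun i hi => by
      have : σ i = true := by simpa [hJ] using hi
      simp [sgn, this]
  have h2 : ∀ d : ι → E, ∑ i ∈ Jᶜ, sgn (σ i) • f i (d i) = -∑ i ∈ Jᶜ, f i (d i) := fun d => by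
    rw [← Finset.sum_neg_distrib]
    exact Finset.sum_congr rfl fun i hi => by
      have : σ i = false := by simpa [hJ] using hi
      simp [sgn, this]
  have h3 := hsub J
  have h4 := hsub Jᶜ
  simp only [h1] at h3
  simp only [h2, norm_neg] at h4
  have h5 : ∫ d, ‖∑ i, f i (d i)‖ ∂P
      ≤ ∫ d, ‖∑ i ∈ J, f i (d i)‖ ∂P + ∫ d, ‖∑ i ∈ Jᶜ, f i (d i)‖ ∂P := by
    rw [← integral_add (hsum J).norm (hsum Jᶜ).norm]
    refine integral_mono (hsum _).norm ((hsum J).norm.add (hsum Jᶜ).norm) fun d => ?_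
    rw [← Finset.sum_add_sum_compl J]
    exact norm_add_le _ _
  linarith

theorem integral_sqrt_le_sqrt_integral {Ω : Type*} [MeasurableSpace Ω] {P : Measure Ω}
    [IsProbabilityMeasure P] {F : Ω → ℝ} (hF : Integrable F P) (h0 : ∀ ω, 0 ≤ F ω) :
    Integrable (fun ω => Real.sqrt (F ω)) P ∧
      ∫ ω, Real.sqrt (F ω) ∂P ≤ Real.sqrt (∫ ω, F ω ∂P) := by
  have hi : Integrable (fun ω => Real.sqrt (F ω)) P := by
    refine Integrable.mono' (hF.add (integrable_const 1))
      (Real.continuous_sqrt.comp_aestronglyMeasurable hF.aestronglyMeasurable)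
      (ae_of_all _ fun ω => ?_)
    rw [Real.norm_of_nonneg (Real.sqrt_nonneg _)]
    simp only [Pi.add_apply]
    nlinarith [Real.sq_sqrt (h0 ω), sq_nonneg (Real.sqrt (F ω) - 1)]
  exact ⟨hi, Real.strictConcaveOn_sqrt.concaveOn.le_map_integral
    Real.continuous_sqrt.continuousOn isClosed_Ici (ae_of_all _ h0) hF hi⟩

/-- The maximal inequality for sums of independent centered random vectors: with the sup norm on
`ℝ^κ`, `E‖∑ fᵢ‖ ≤ √(8 log(2|κ|)) (∑ E‖fᵢ‖²)^{1/2}`. -/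
theorem integral_norm_sum_le {κ : Type*} [Fintype κ] [Nonempty κ] (ν : Measure E)
    [IsProbabilityMeasure ν] {f : ι → E → κ → ℝ}
    (hf : ∀ i, MemLp (f i) 2 ν) (h0 : ∀ i, ∫ x, f i x ∂ν = 0) :
    ∫ d, ‖∑ i, f i (d i)‖ ∂(Measure.pi fun _ => ν)
      ≤ Real.sqrt (8 * Real.log (2 * Fintype.card κ))
        * Real.sqrt (∑ i, ∫ x, ‖f i x‖ ^ 2 ∂ν) := by
  set P : Measure (ι → E) := Measure.pi fun _ => ν with hP
  have hf1 : ∀ i, Integrable (f i) ν := fun i => (hf i).integrable (by norm_num)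
  have hsgn : ∀ σ : ι → Bool, Integrable (fun d : ι → E => ‖∑ i, sgn (σ i) • f i (d i)‖) P :=
    fun σ => (integrable_finsetSum _ fun i _ => ((measurePreserving_coord ν
      i).integrable_comp_of_integrable (hf1 i)).smul (sgn (σ i))).norm
  have hsq : ∀ i, Integrable (fun x => ‖f i x‖ ^ 2) ν := fun i =>
    (memLp_two_iff_integrable_sq_norm (hf i).aestronglyMeasurable).mp (hf i)
  have hF : Integrable (fun d : ι → E => ∑ i, ‖f i (d i)‖ ^ 2) P :=
    integrable_finsetSum _ fun i _ =>
      (measurePreserving_coord ν i).integrable_comp_of_integrable (hsq i)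
  obtain ⟨hsi, hsl⟩ := integral_sqrt_le_sqrt_integral hF
    fun d => Finset.sum_nonneg fun i _ => sq_nonneg _
  have hsqi : ∀ i, Integrable (fun d : ι → E => ‖f i (d i)‖ ^ 2) P := fun i =>
    (measurePreserving_coord ν i).integrable_comp_of_integrable (hsq i)
  have eF : ∫ d, ∑ i, ‖f i (d i)‖ ^ 2 ∂P = ∑ i, ∫ x, ‖f i x‖ ^ 2 ∂ν := by
    rw [integral_finsetSum _ fun i _ => hsqi i]
    refine Finset.sum_congr rfl fun i _ => ?_
    have hmi := measurePreserving_coord (ι := ι) ν i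
    have h2 := integral_map (f := fun x => ‖f i x‖ ^ 2) hmi.measurable.aemeasurable
      (by rw [hmi.map_eq]; exact (hsq i).aestronglyMeasurable)
    rw [hmi.map_eq] at h2
    exact h2.symm
  have hN : (0 : ℝ) < 2 ^ Fintype.card ι := by positivity
  have havg : ∫ d, ‖∑ i, f i (d i)‖ ∂P ≤ 2 * ∫ d, ((2 : ℝ) ^ Fintype.card ι)⁻¹ *
      ∑ σ : ι → Bool, ‖∑ i, sgn (σ i) • f i (d i)‖ ∂P := by
    rw [integral_const_mul, integral_finsetSum _ fun σ _ => hsgn σ]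
    have := Finset.sum_le_sum fun (σ : ι → Bool) (_ : σ ∈ Finset.univ) =>
      integral_norm_sum_le_two_mul ν hf1 h0 σ
    rw [Finset.sum_const, Finset.card_univ, nsmul_eq_mul, ← Finset.mul_sum] at this
    simp only [Fintype.card_pi, Fintype.card_bool, Finset.prod_const, Finset.card_univ,
      Nat.cast_pow, Nat.cast_ofNat] at this
    rw [← mul_assoc, mul_comm 2, mul_assoc, ← div_eq_inv_mul, le_div_iff₀ hN, mul_comm]
    exact this
  refine havg.trans ?_
  have h8 : Real.sqrt (8 * Real.log (2 * Fintype.card κ))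
      = 2 * Real.sqrt (2 * Real.log (2 * Fintype.card κ)) := by
    rw [show 8 * Real.log (2 * Fintype.card κ) = 2 ^ 2 * (2 * Real.log (2 * Fintype.card κ)) by
      ring, Real.sqrt_mul (by norm_num), Real.sqrt_sq (by norm_num)]
  rw [h8, mul_assoc]
  refine mul_le_mul_of_nonneg_left ?_ two_pos.le
  calc _ ≤ ∫ d, Real.sqrt (2 * Real.log (2 * Fintype.card κ))
          * Real.sqrt (∑ i, ‖f i (d i)‖ ^ 2) ∂P :=
        integral_mono ((integrable_finsetSum _ fun σ _ => hsgn σ).const_mul _)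
          (hsi.const_mul _) fun d => sum_norm_sgn_le fun i => f i (d i)
    _ ≤ _ := by
        rw [integral_const_mul, ← eF]
        exact mul_le_mul_of_nonneg_left hsl (Real.sqrt_nonneg _)

end Product

namespace Setup

variable {Ω 𝒱 𝒮 : Type*} [MeasurableSpace Ω] [MeasurableSpace 𝒱] [MeasurableSpace 𝒮]
  {D : Setup Ω 𝒱 𝒮} {μ : Measure Ω}

/-! ### The law of the sample -/

/-- The law of one observation. -/
def law (D : Setup Ω 𝒱 𝒮) (μ : Measure Ω) : Measure (ℝ × ℝ × 𝒱) := μ.map (D.obs 0)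

/-- The observations of the sample of size `n`. -/
def sample (D : Setup Ω 𝒱 𝒮) (n : ℕ) (ω : Ω) (i : Fin n) : ℝ × ℝ × 𝒱 := D.obs i ω

theorem measurable_obs (i : ℕ) : Measurable (D.obs i) :=
  (D.measurable_Y i).prodMk ((D.measurable_T i).prodMk (D.measurable_V i))

theorem measurable_sample (n : ℕ) : Measurable (D.sample n) :=
  measurable_pi_lambda _ fun i => measurable_obs i

instance [IsProbabilityMeasure μ] : IsProbabilityMeasure (D.law μ) :=
  Measure.isProbabilityMeasure_map (measurable_obs 0).aemeasurable

theorem RandomSample.map_obs (h : D.RandomSample μ) (i : ℕ) : μ.map (D.obs i) = D.law μ :=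
  (h.2.1 i).map_eq

theorem RandomSample.map_sample [IsProbabilityMeasure μ] (h : D.RandomSample μ) (n : ℕ) :
    μ.map (D.sample n) = Measure.pi fun _ => D.law μ := by
  have h1 : iIndepFun (fun i : Fin n => D.obs i) μ := h.1.precomp Fin.val_injective
  have h2 := (iIndepFun_iff_map_fun_eq_pi_map fun i : Fin n =>
    (measurable_obs (D := D) (i : ℕ)).aemeasurable).mp h1
  simp only [h.map_obs] at h2
  exact h2

theorem RandomSample.map_seed_sample [IsProbabilityMeasure μ] (h : D.RandomSample μ) (n : ℕ) :
    μ.map (fun ω => (D.S ω, D.sample n ω)) = (μ.map D.S).prod (Measure.pi fun _ => D.law μ) := by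
  have h1 : IndepFun D.S (D.sample n) μ :=
    h.2.2.comp (φ := id) (ψ := fun (d : ℕ → ℝ × ℝ × 𝒱) (i : Fin n) => d i) measurable_id
      (by fun_prop)
  rw [(indepFun_iff_map_prod_eq_prod_map_map D.measurable_S.aemeasurable
    (measurable_sample n).aemeasurable).mp h1, h.map_sample]

theorem lintegral_law {f : ℝ × ℝ × 𝒱 → ℝ≥0∞} (hf : Measurable f) :
    ∫⁻ x, f x ∂D.law μ = ∫⁻ ω, f (D.obs 0 ω) ∂μ :=
  lintegral_map hf (measurable_obs 0)

theorem integral_law {f : ℝ × ℝ × 𝒱 → ℝ} (hf : Measurable f) :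
    ∫ x, f x ∂D.law μ = ∫ ω, f (D.obs 0 ω) ∂μ :=
  integral_map (measurable_obs 0).aemeasurable hf.aestronglyMeasurable

theorem integrable_law_iff {f : ℝ × ℝ × 𝒱 → ℝ} (hf : Measurable f) :
    Integrable f (D.law μ) ↔ Integrable (fun ω => f (D.obs 0 ω)) μ :=
  integrable_map_measure hf.aestronglyMeasurable (measurable_obs 0).aemeasurable

theorem memLp_law_iff {f : ℝ × ℝ × 𝒱 → ℝ} (hf : Measurable f) :
    MemLp f 2 (D.law μ) ↔ MemLp (fun ω => f (D.obs 0 ω)) 2 μ :=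
  memLp_map_measure_iff hf.aestronglyMeasurable (measurable_obs 0).aemeasurable

theorem ae_law {p : ℝ × ℝ × 𝒱 → Prop} (hp : MeasurableSet {x | p x})
    (h : ∀ᵐ ω ∂μ, p (D.obs 0 ω)) : ∀ᵐ x ∂D.law μ, p x :=
  (ae_map_iff (measurable_obs 0).aemeasurable hp).mpr h

theorem RandomSample.lintegral_eq [IsProbabilityMeasure μ] (h : D.RandomSample μ) {n : ℕ}
    {f : 𝒮 × (Fin n → ℝ × ℝ × 𝒱) → ℝ≥0∞} (hf : Measurable f) :
    ∫⁻ ω, f (D.S ω, D.sample n ω) ∂μ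
      = ∫⁻ s, ∫⁻ d, f (s, d) ∂(Measure.pi fun _ => D.law μ) ∂(μ.map D.S) := by
  rw [← lintegral_prod _ hf.aemeasurable, ← h.map_seed_sample,
    lintegral_map hf (D.measurable_S.prodMk (measurable_sample n))]

/-- The fold `k` of the sample of size `n`. -/
def foldSet (D : Setup Ω 𝒱 𝒮) (n : ℕ) (k : Fin D.K) (s : 𝒮) : Finset (Fin n) :=
  Finset.univ.filter fun i => D.fold n s i = k

/-- Cross-fitting: if `Ψ s d d'` depends on `d` only through the observations outside the fold `k`,
and on `d'` only through those inside, then the second argument may be replaced by a fresh sample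
which is independent of the seed and of the first. -/
theorem RandomSample.lintegral_crossfit [IsProbabilityMeasure μ] (h : D.RandomSample μ) {n : ℕ}
    (k : Fin D.K) {Ψ : 𝒮 → (Fin n → ℝ × ℝ × 𝒱) → (Fin n → ℝ × ℝ × 𝒱) → ℝ≥0∞}
    (hΨ : Measurable fun q : 𝒮 × (Fin n → ℝ × ℝ × 𝒱) × (Fin n → ℝ × ℝ × 𝒱) => Ψ q.1 q.2.1 q.2.2)
    (hglue : ∀ s d d', Ψ s (glue (D.foldSet n k s) d d') (glue (D.foldSet n k s) d d')
      = Ψ s d d') :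
    ∫⁻ ω, Ψ (D.S ω) (D.sample n ω) (D.sample n ω) ∂μ
      = ∫⁻ ω, ∫⁻ d', Ψ (D.S ω) (D.sample n ω) d' ∂(Measure.pi fun _ => D.law μ) ∂μ := by
  have h1 : Measurable fun q : 𝒮 × (Fin n → ℝ × ℝ × 𝒱) => Ψ q.1 q.2 q.2 :=
    hΨ.comp (measurable_fst.prodMk (measurable_snd.prodMk measurable_snd))
  have h2 : Measurable fun q : 𝒮 × (Fin n → ℝ × ℝ × 𝒱) =>
      ∫⁻ d', Ψ q.1 q.2 d' ∂(Measure.pi fun _ => D.law μ) :=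
    Measurable.lintegral_prod_right'
      (f := fun r : (𝒮 × (Fin n → ℝ × ℝ × 𝒱)) × (Fin n → ℝ × ℝ × 𝒱) => Ψ r.1.1 r.1.2 r.2)
      (hΨ.comp (measurable_fst.fst.prodMk (measurable_fst.snd.prodMk measurable_snd)))
  rw [h.lintegral_eq h1, h.lintegral_eq h2]
  refine lintegral_congr fun s => ?_
  exact lintegral_diag_eq (D.law μ) (D.foldSet n k s)
    (hΨ.comp (measurable_const.prodMk (measurable_fst.prodMk measurable_snd))) (hglue s)

/-- The weak law of large numbers for functions of one observation. -/
theorem RandomSample.tendsto_measure_avg [IsProbabilityMeasure μ] (h : D.RandomSample μ)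
    {f : ℝ × ℝ × 𝒱 → ℝ} (hf : Measurable f) (hi : Integrable f (D.law μ)) {t : ℝ} (ht : 0 < t) :
    Tendsto (fun n : ℕ => μ {ω | t ≤ |1 / (n : ℝ) * ∑ i : Fin n, f (D.obs i ω)
      - ∫ x, f x ∂D.law μ|}) atTop (𝓝 0) := by
  have h1 := strong_law_ae_real (μ := μ) (fun i ω => f (D.obs i ω))
    ((integrable_law_iff hf).mp hi)
    (fun i j hij => (h.1.indepFun hij).comp hf hf) (fun i => (h.2.1 i).comp hf)
  have h2 := tendstoInMeasure_of_tendsto_ae (μ := μ)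
    (f := fun (n : ℕ) ω => (∑ i ∈ Finset.range n, f (D.obs i ω)) / n)
    (g := fun _ => ∫ ω, f (D.obs 0 ω) ∂μ) (fun n =>
      ((Finset.measurable_fun_sum _ fun i _ => hf.comp
        (measurable_obs i)).div_const _).aestronglyMeasurable) h1
  rw [tendstoInMeasure_iff_dist] at h2
  refine (h2 t ht).congr fun n => ?_
  congr 1
  ext ω
  rw [Set.mem_ofPred_eq, Set.mem_ofPred_eq, Real.dist_eq, integral_law hf,
    Fin.sum_univ_eq_sum_range (fun i => f (D.obs i ω)) n, one_div, div_eq_inv_mul]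

/-! ### Inverse propensity weights and moment conditions -/

/-- The inverse propensity weight as a function of the observation. -/
def weight (D : Setup Ω 𝒱 𝒮) (x : ℝ × ℝ × 𝒱) : ℝ :=
  (x.2.1 - D.ps x.2.2) / (D.ps x.2.2 * (1 - D.ps x.2.2))

theorem measurable_weight : Measurable D.weight := by
  have := D.measurable_ps
  unfold weight
  fun_prop

theorem measurable_regressor (n : ℕ) (j : Fin (D.p n)) : Measurable fun v => D.φ n v j :=
  (measurable_pi_apply j).comp (D.measurable_φ n)

theorem abs_div_propensity_le {ξ p y : ℝ} (hξ : 0 < ξ) (h1 : ξ < p) (h2 : p < 1 - ξ) :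
    |y / (p * (1 - p))| ≤ (ξ ^ 2)⁻¹ * |y| := by
  have h3 : ξ ^ 2 ≤ p * (1 - p) := by nlinarith
  have h4 : 0 < ξ ^ 2 := by positivity
  rw [abs_div, abs_of_pos (h4.trans_le h3), div_eq_inv_mul]
  exact mul_le_mul_of_nonneg_right (inv_anti₀ h4 h3) (abs_nonneg _)

theorem Overlap.abs_weight_le {ξ : ℝ} (h : D.Overlap μ ξ) :
    ∀ᵐ x ∂D.law μ, |D.weight x| ≤ (ξ ^ 2)⁻¹ := by
  refine ae_law (measurableSet_le measurable_weight.abs measurable_const) ?_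
  filter_upwards [h.2.2] with ω hω
  have h1 := abs_div_propensity_le (y := D.T 0 ω - D.ps (D.V 0 ω)) h.1 hω.1 hω.2
  have h2 : |D.T 0 ω - D.ps (D.V 0 ω)| ≤ 1 := by
    have := h.1
    rw [abs_le]
    rcases D.T_binary 0 ω with h0 | h0 <;> rw [h0] <;> constructor <;> linarith [hω.1, hω.2]
  have h3 : 0 < (ξ ^ 2)⁻¹ := by have := h.1; positivity
  exact h1.trans (mul_le_of_le_one_right h3.le h2)

/-- Multiplying a square integrable function by the weight keeps it square integrable. -/
theorem Overlap.memLp_mul_weight {ξ : ℝ} (h : D.Overlap μ ξ) {f : ℝ × ℝ × 𝒱 → ℝ}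
    (hf : MemLp f 2 (D.law μ)) : MemLp (fun x => f x * D.weight x) 2 (D.law μ) := by
  refine (hf.const_mul (ξ ^ 2)⁻¹).of_le
    (hf.aestronglyMeasurable.mul measurable_weight.aestronglyMeasurable) ?_
  filter_upwards [h.abs_weight_le] with x hx
  have h3 : 0 ≤ (ξ ^ 2)⁻¹ := by positivity
  rw [norm_mul, norm_mul, Real.norm_of_nonneg h3, mul_comm]
  exact mul_le_mul_of_nonneg_right hx (norm_nonneg _)

theorem sigmaV_le : D.sigmaV ≤ (inferInstance : MeasurableSpace Ω) :=
  (D.measurable_V 0).comap_le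

/-- The weight is conditionally centered given the covariates. -/
theorem Overlap.integral_mul_weight [IsProbabilityMeasure μ] {ξ : ℝ} (h : D.Overlap μ ξ)
    {g : 𝒱 → ℝ} (hg : Measurable g) (hi : Integrable (fun ω => g (D.V 0 ω)) μ) :
    ∫ x, g x.2.2 * D.weight x ∂D.law μ = 0 := by
  have hps := D.measurable_ps
  rw [integral_law (f := fun x => g x.2.2 * D.weight x)
    ((hg.comp measurable_snd.snd).mul measurable_weight)]
  set H : 𝒱 → ℝ := fun v => g v / (D.ps v * (1 - D.ps v)) with hH
  have hHm : Measurable H := by fun_prop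
  have hHi : Integrable (fun ω => H (D.V 0 ω)) μ := by
    refine (hi.norm.const_mul (ξ ^ 2)⁻¹).mono' (hHm.comp (D.measurable_V 0)).aestronglyMeasurable ?_
    filter_upwards [h.2.2] with ω hω
    exact abs_div_propensity_le h.1 hω.1 hω.2
  have hT1 : ∀ᵐ ω ∂μ, ‖D.T 0 ω‖ ≤ 1 := ae_of_all _ fun ω => by
    rcases D.T_binary 0 ω with h0 | h0 <;> simp [h0]
  have hTi : Integrable (D.T 0) μ := (integrable_const (1 : ℝ)).mono'
    (D.measurable_T 0).aestronglyMeasurable hT1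
  have hHT : Integrable (fun ω => H (D.V 0 ω) * D.T 0 ω) μ :=
    hHi.mul_bdd (D.measurable_T 0).aestronglyMeasurable hT1
  have hps1 : ∀ᵐ ω ∂μ, ‖D.ps (D.V 0 ω)‖ ≤ 1 := by
    filter_upwards [h.2.2] with ω hω
    have := h.1
    rw [Real.norm_eq_abs, abs_le]
    constructor <;> linarith [hω.1, hω.2]
  have hHp : Integrable (fun ω => H (D.V 0 ω) * D.ps (D.V 0 ω)) μ :=
    hHi.mul_bdd (hps.comp (D.measurable_V 0)).aestronglyMeasurable hps1
  have hHs : StronglyMeasurable[D.sigmaV] (fun ω => H (D.V 0 ω)) :=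
    (hHm.comp (comap_measurable (D.V 0))).stronglyMeasurable
  have h1 := condExp_mul_of_stronglyMeasurable_left (m := D.sigmaV) hHs hHT hTi
  have h2 : ∫ ω, H (D.V 0 ω) * D.T 0 ω ∂μ = ∫ ω, H (D.V 0 ω) * D.ps (D.V 0 ω) ∂μ := by
    rw [← integral_condExp (sigmaV_le (D := D))]
    refine integral_congr_ae ?_
    filter_upwards [h1, h.2.1] with ω h3 h4
    rw [← h4]
    exact h3
  calc ∫ ω, g (D.obs 0 ω).2.2 * D.weight (D.obs 0 ω) ∂μ
      = ∫ ω, (H (D.V 0 ω) * D.T 0 ω - H (D.V 0 ω) * D.ps (D.V 0 ω)) ∂μ := by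
        refine integral_congr_ae (ae_of_all _ fun ω => ?_)
        simp only [obs, weight, hH]
        ring
    _ = 0 := by rw [integral_sub hHT hHp, h2, sub_self]

/-- The regression error as a function of the observation. -/
def error (D : Setup Ω 𝒱 𝒮) (β : (n : ℕ) → Fin (D.p n) → ℝ) (n : ℕ) (x : ℝ × ℝ × 𝒱) : ℝ :=
  x.1 * D.weight x - D.φ n x.2.2 ⬝ᵥ β n

theorem measurable_dotProduct_regressor (n : ℕ) (b : Fin (D.p n) → ℝ) :
    Measurable fun v => D.φ n v ⬝ᵥ b := by
  simp only [dotProduct]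
  exact Finset.measurable_fun_sum _ fun j _ => (measurable_regressor n j).mul_const _

theorem measurable_error (β : (n : ℕ) → Fin (D.p n) → ℝ) (n : ℕ) : Measurable (D.error β n) :=
  (measurable_fst.mul measurable_weight).sub
    ((measurable_dotProduct_regressor n _).comp measurable_snd.snd)

theorem BoundedRegressors.norm_regressor_le {C : ℝ} (h : D.BoundedRegressors μ C) (n : ℕ) :
    ∀ᵐ x ∂D.law μ, ‖D.φ n x.2.2‖ ≤ C := by
  refine ae_law (p := fun x => ‖D.φ n x.2.2‖ ≤ C) (measurableSet_le
    ((D.measurable_φ n).comp measurable_snd.snd).norm measurable_const) ?_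
  filter_upwards [ae_all_iff.mpr (h.2 n)] with ω hω
  exact (pi_norm_le_iff_of_nonneg h.1.le).mpr hω

theorem BoundedRegressors.memLp_dotProduct [IsProbabilityMeasure μ] {C : ℝ}
    (h : D.BoundedRegressors μ C) (n : ℕ) (b : Fin (D.p n) → ℝ) :
    MemLp (fun x => D.φ n x.2.2 ⬝ᵥ b) 2 (D.law μ) := by
  refine MemLp.of_bound ((measurable_dotProduct_regressor n b).comp
    measurable_snd.snd).aestronglyMeasurable (C * ∑ j, |b j|) ?_
  filter_upwards [h.norm_regressor_le n] with x hx
  exact (abs_dotProduct_le _ _).trans (mul_le_mul_of_nonneg_right hx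
    (Finset.sum_nonneg fun _ _ => abs_nonneg _))

/-- The regression error is uncorrelated with the regressors. -/
theorem LinearModel.integral_regressor_mul_error [IsProbabilityMeasure μ]
    {β : (n : ℕ) → Fin (D.p n) → ℝ} {C : ℝ} (h : D.LinearModel μ β)
    (hb : D.BoundedRegressors μ C) {n : ℕ} (he : MemLp (D.e β n 0) 2 μ) (j : Fin (D.p n)) :
    ∫ x, D.φ n x.2.2 j * D.error β n x ∂D.law μ = 0 := by
  have hφ := measurable_regressor (D := D) n j
  rw [integral_law (f := fun x => D.φ n x.2.2 j * D.error β n x)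
    ((hφ.comp measurable_snd.snd).mul (measurable_error β n))]
  have hlin : Integrable (fun ω => D.φ n (D.V 0 ω) ⬝ᵥ β n) μ :=
    (integrable_law_iff ((measurable_dotProduct_regressor n (β n)).comp
      measurable_snd.snd)).mp ((hb.memLp_dotProduct n (β n)).integrable (by norm_num))
  have hei : Integrable (D.e β n 0) μ := he.integrable (by norm_num)
  have hYW : Integrable (D.YW 0) μ := by
    refine (hei.add hlin).congr (ae_of_all _ fun ω => ?_)
    simp [e]
  have hφb : ∀ᵐ ω ∂μ, ‖D.φ n (D.V 0 ω) j‖ ≤ C := hb.2 n j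
  have hφm := (hφ.comp (D.measurable_V 0)).aestronglyMeasurable (μ := μ)
  have hi1 : Integrable (fun ω => D.φ n (D.V 0 ω) j * D.YW 0 ω) μ := hYW.bdd_mul hφm hφb
  have hi2 : Integrable (fun ω => D.φ n (D.V 0 ω) j * (D.φ n (D.V 0 ω) ⬝ᵥ β n)) μ :=
    hlin.bdd_mul hφm hφb
  have hs : StronglyMeasurable[D.sigmaV] (fun ω => D.φ n (D.V 0 ω) j) :=
    (hφ.comp (comap_measurable (D.V 0))).stronglyMeasurable
  have h1 := condExp_mul_of_stronglyMeasurable_left (m := D.sigmaV) hs hi1 hYW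
  have h2 : ∫ ω, D.φ n (D.V 0 ω) j * D.YW 0 ω ∂μ
      = ∫ ω, D.φ n (D.V 0 ω) j * (D.φ n (D.V 0 ω) ⬝ᵥ β n) ∂μ := by
    rw [← integral_condExp (sigmaV_le (D := D))]
    refine integral_congr_ae ?_
    filter_upwards [h1, h n] with ω h3 h4
    rw [← h4]
    exact h3
  calc ∫ ω, D.φ n (D.obs 0 ω).2.2 j * D.error β n (D.obs 0 ω) ∂μ
      = ∫ ω, (D.φ n (D.V 0 ω) j * D.YW 0 ω
          - D.φ n (D.V 0 ω) j * (D.φ n (D.V 0 ω) ⬝ᵥ β n)) ∂μ := by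
        refine integral_congr_ae (ae_of_all _ fun ω => ?_)
        simp only [obs, error, weight, YW, W]
        ring
    _ = 0 := by rw [integral_sub hi1 hi2, h2, sub_self]


/-! ### Maximal inequalities for the scores -/

instance (n : ℕ) : Nonempty (Fin (D.p n)) := Fin.pos_iff_nonempty.mp (D.p_pos n)

theorem log_two_mul_p_pos (n : ℕ) : 0 < Real.log (2 * (D.p n : ℝ)) := by
  have : (1 : ℝ) ≤ D.p n := by exact_mod_cast D.p_pos n
  exact Real.log_pos (by linarith)

theorem rate_pos {n : ℕ} (hn : 0 < n) : 0 < D.rate n :=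
  Real.sqrt_pos.mpr (div_pos (log_two_mul_p_pos n) (by exact_mod_cast hn))

theorem sqrt_mul_sqrt_eq_rate {n : ℕ} (hn : 0 < n) {C a : ℝ} (hC : 0 ≤ C) :
    Real.sqrt (8 * Real.log (2 * (D.p n : ℝ))) * Real.sqrt (n * (C ^ 2 * a))
      = n * (Real.sqrt 8 * C * Real.sqrt a * D.rate n) := by
  have hn' : (0 : ℝ) < n := by exact_mod_cast hn
  rw [rate, Real.sqrt_mul (by norm_num), Real.sqrt_mul hn'.le, Real.sqrt_mul (sq_nonneg C),
    Real.sqrt_sq hC, Real.sqrt_div (log_two_mul_p_pos n).le]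
  calc _ = Real.sqrt n * (Real.sqrt 8 * C * Real.sqrt a
          * Real.sqrt (Real.log (2 * (D.p n : ℝ)))) := by ring
    _ = n / Real.sqrt n * (Real.sqrt 8 * C * Real.sqrt a
          * Real.sqrt (Real.log (2 * (D.p n : ℝ)))) := by rw [Real.div_sqrt]
    _ = _ := by ring

theorem transpose_mulVec_eq_sum (n : ℕ) (ω : Ω) (y : Fin n → ℝ) :
    (D.Xmat n ω)ᵀ *ᵥ y = ∑ i, y i • D.φ n (D.sample n ω i).2.2 := by
  ext j
  simp only [Matrix.mulVec, dotProduct, Matrix.transpose_apply, Xmat, Matrix.of_apply,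
    Finset.sum_apply, Pi.smul_apply, smul_eq_mul, sample, obs]
  exact Finset.sum_congr rfl fun i _ => mul_comm _ _

/-- The maximal inequality for sums of terms `G(x) φ(x)` that are centered. -/
theorem BoundedRegressors.integral_norm_sum_smul_le [IsProbabilityMeasure μ] {C : ℝ}
    (hb : D.BoundedRegressors μ C) {n : ℕ} {G : Fin n → ℝ × ℝ × 𝒱 → ℝ}
    (hG : ∀ i, MemLp (G i) 2 (D.law μ))
    (h0 : ∀ i j, ∫ x, D.φ n x.2.2 j * G i x ∂D.law μ = 0) :
    Integrable (fun d : Fin n → ℝ × ℝ × 𝒱 => ∑ i, G i (d i) • D.φ n (d i).2.2)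
        (Measure.pi fun _ => D.law μ) ∧
      ∫ d : Fin n → ℝ × ℝ × 𝒱, ‖∑ i, G i (d i) • D.φ n (d i).2.2‖
          ∂(Measure.pi fun _ => D.law μ)
        ≤ Real.sqrt (8 * Real.log (2 * (D.p n : ℝ)))
          * Real.sqrt (∑ i, C ^ 2 * ∫ x, G i x ^ 2 ∂D.law μ) := by
  set f : Fin n → ℝ × ℝ × 𝒱 → Fin (D.p n) → ℝ := fun i x => G i x • D.φ n x.2.2 with hf
  have hφ : AEStronglyMeasurable (fun x : ℝ × ℝ × 𝒱 => D.φ n x.2.2) (D.law μ) :=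
    ((D.measurable_φ n).comp measurable_snd.snd).aestronglyMeasurable
  have hle : ∀ i, ∀ᵐ x ∂D.law μ, ‖f i x‖ ≤ C * ‖G i x‖ := fun i => by
    filter_upwards [hb.norm_regressor_le n] with x hx
    rw [hf, norm_smul, mul_comm]
    exact mul_le_mul_of_nonneg_right hx (norm_nonneg _)
  have hfL : ∀ i, MemLp (f i) 2 (D.law μ) := fun i => by
    refine ((hG i).const_mul C).of_le ((hG i).aestronglyMeasurable.smul hφ) ?_
    filter_upwards [hle i] with x hx
    rwa [norm_mul, Real.norm_of_nonneg hb.1.le]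
  have hfi : ∀ i, Integrable (f i) (D.law μ) := fun i => (hfL i).integrable (by norm_num)
  have hf0 : ∀ i, ∫ x, f i x ∂D.law μ = 0 := fun i => by
    ext j
    rw [eval_integral fun j => (hfi i).eval j, Pi.zero_apply, ← h0 i j]
    exact integral_congr_ae (ae_of_all _ fun x => by simp [hf, mul_comm])
  refine ⟨integrable_finsetSum _ fun i _ => (measurePreserving_coord (D.law μ)
    i).integrable_comp_of_integrable (hfi i), ?_⟩
  have key := integral_norm_sum_le (D.law μ) hfL hf0
  rw [Fintype.card_fin] at key
  refine key.trans (mul_le_mul_of_nonneg_left (Real.sqrt_le_sqrt ?_) (Real.sqrt_nonneg _))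
  refine Finset.sum_le_sum fun i _ => ?_
  rw [← integral_const_mul]
  refine integral_mono_ae ((memLp_two_iff_integrable_sq_norm (hfL i).aestronglyMeasurable).mp
    (hfL i)) ((hG i).integrable_sq.const_mul _) ?_
  filter_upwards [hle i] with x hx
  calc ‖f i x‖ ^ 2 ≤ (C * ‖G i x‖) ^ 2 := pow_le_pow_left₀ (norm_nonneg _) hx 2
    _ = C ^ 2 * G i x ^ 2 := by rw [mul_pow, Real.norm_eq_abs, sq_abs]

/-- The mean sup norm of the score `n⁻¹ X'G` of a centered function `G` of the observations. -/
theorem BoundedRegressors.integral_norm_score_le [IsProbabilityMeasure μ] {C : ℝ}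
    (hb : D.BoundedRegressors μ C) (hs : D.RandomSample μ) {n : ℕ} (hn : 0 < n)
    {G : ℝ × ℝ × 𝒱 → ℝ} (hG : MemLp G 2 (D.law μ))
    (h0 : ∀ j, ∫ x, D.φ n x.2.2 j * G x ∂D.law μ = 0) :
    Integrable (fun ω => ‖(1 / (n : ℝ)) • ((D.Xmat n ω)ᵀ *ᵥ fun i => G (D.obs i ω))‖) μ ∧
      ∫ ω, ‖(1 / (n : ℝ)) • ((D.Xmat n ω)ᵀ *ᵥ fun i => G (D.obs i ω))‖ ∂μ
        ≤ Real.sqrt 8 * C * Real.sqrt (∫ x, G x ^ 2 ∂D.law μ) * D.rate n := by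
  have hn' : (0 : ℝ) < n := by exact_mod_cast hn
  obtain ⟨hi, hle⟩ := hb.integral_norm_sum_smul_le (n := n) (G := fun _ => G) (fun _ => hG)
    fun _ => h0
  rw [Finset.sum_const, Finset.card_univ, Fintype.card_fin, nsmul_eq_mul,
    sqrt_mul_sqrt_eq_rate hn hb.1.le] at hle
  have e1 : ∀ ω, ‖(1 / (n : ℝ)) • ((D.Xmat n ω)ᵀ *ᵥ fun i => G (D.obs i ω))‖
      = 1 / (n : ℝ) * ‖∑ i, G (D.sample n ω i) • D.φ n (D.sample n ω i).2.2‖ := fun ω => by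
    rw [transpose_mulVec_eq_sum, norm_smul, Real.norm_of_nonneg (by positivity)]
    rfl
  simp only [e1]
  rw [← hs.map_sample] at hi hle
  have hm := (measurable_sample (D := D) n).aemeasurable (μ := μ)
  rw [integral_map hm hi.norm.aestronglyMeasurable] at hle
  refine ⟨((integrable_map_measure hi.norm.aestronglyMeasurable hm).mp hi.norm).const_mul _, ?_⟩
  rw [integral_const_mul, one_div, inv_mul_le_iff₀ hn']
  exact hle

/-! ### The error of the cross-fitted nuisance estimates -/

/-- The contribution of the fold `k` to the nuisance error: `(B̂(V) - B(V)) W` at the observation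
`x` if the index `i` lies in the fold `k`, with `B̂` computed from the sample `d`. -/
def foldError (D : Setup Ω 𝒱 𝒮) (B : 𝒱 → ℝ) (n : ℕ) (k : Fin D.K) (s : 𝒮)
    (d : Fin n → ℝ × ℝ × 𝒱) (i : Fin n) (x : ℝ × ℝ × 𝒱) : ℝ :=
  if D.fold n s i = k then (D.learner n k s d x.2.2 - B x.2.2) * D.weight x else 0

/-- The nuisance error `(B̂(V) - B(V)) W`, which is the second column of `Ẑ - Z`. -/
def nuisanceError (D : Setup Ω 𝒱 𝒮) (B : 𝒱 → ℝ) (n : ℕ) (ω : Ω) (i : Fin n) : ℝ :=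
  (D.Bhat n (D.foldOf n ω i) ω (D.V i ω) - B (D.V i ω)) * D.W i ω

/-- The squared `L²` error of the nuisance function which the learner returns for the fold `k`. -/
def learnerError (D : Setup Ω 𝒱 𝒮) (μ : Measure Ω) (B : 𝒱 → ℝ) (n : ℕ) (k : Fin D.K) (s : 𝒮)
    (d : Fin n → ℝ × ℝ × 𝒱) : ℝ≥0∞ :=
  ∫⁻ v, ENNReal.ofReal ((D.learner n k s d v - B v) ^ 2) ∂(μ.map (D.V 0))

variable {B : 𝒱 → ℝ}

theorem nuisanceError_eq_sum (n : ℕ) (ω : Ω) (i : Fin n) : D.nuisanceError B n ω i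
    = ∑ k, D.foldError B n k (D.S ω) (D.sample n ω) i (D.sample n ω i) := by
  simp only [foldError, Finset.sum_ite_eq, Finset.mem_univ, if_true]
  rfl

theorem nuisanceError_sq_eq_sum (n : ℕ) (ω : Ω) (i : Fin n) : D.nuisanceError B n ω i ^ 2
    = ∑ k, D.foldError B n k (D.S ω) (D.sample n ω) i (D.sample n ω i) ^ 2 := by
  simp only [foldError, ite_pow, ne_eq, OfNat.ofNat_ne_zero, not_false_eq_true, zero_pow,
    Finset.sum_ite_eq, Finset.mem_univ, if_true]
  rfl

theorem measurable_learner_sub (hB : Measurable B) (n : ℕ) (k : Fin D.K) :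
    Measurable fun q : 𝒮 × (Fin n → ℝ × ℝ × 𝒱) × 𝒱 => D.learner n k q.1 q.2.1 q.2.2 - B q.2.2 :=
  (D.measurable_learner n k).sub (hB.comp measurable_snd.snd)

theorem measurable_foldError (hB : Measurable B) (n : ℕ) (k : Fin D.K) (i : Fin n) :
    Measurable fun q : 𝒮 × (Fin n → ℝ × ℝ × 𝒱) × (ℝ × ℝ × 𝒱) =>
      D.foldError B n k q.1 q.2.1 i q.2.2 := by
  refine Measurable.ite ?_ ?_ measurable_const
  · exact ((measurable_pi_apply i).comp ((D.measurable_fold n).comp measurable_fst))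
      (measurableSet_singleton k)
  · exact ((measurable_learner_sub hB n k).comp (measurable_fst.prodMk
      (measurable_snd.fst.prodMk measurable_snd.snd.snd.snd))).mul
      (measurable_weight.comp measurable_snd.snd)

theorem measurable_foldError_diag (hB : Measurable B) (n : ℕ) (k : Fin D.K) (i : Fin n) :
    Measurable fun q : 𝒮 × (Fin n → ℝ × ℝ × 𝒱) × (Fin n → ℝ × ℝ × 𝒱) =>
      D.foldError B n k q.1 q.2.1 i (q.2.2 i) :=
  (measurable_foldError hB n k i).comp (measurable_fst.prodMk
    (measurable_snd.fst.prodMk ((measurable_pi_apply i).comp measurable_snd.snd)))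

theorem measurable_seed_sample_sample (n : ℕ) :
    Measurable fun ω => (D.S ω, D.sample n ω, D.sample n ω) :=
  D.measurable_S.prodMk ((measurable_sample n).prodMk (measurable_sample n))

theorem measurable_nuisanceError (hB : Measurable B) (n : ℕ) (i : Fin n) :
    Measurable fun ω => D.nuisanceError B n ω i := by
  simp only [nuisanceError_eq_sum]
  exact Finset.measurable_fun_sum _ fun k _ => (measurable_foldError_diag hB n k i).comp
    (measurable_seed_sample_sample n)

theorem learner_glue (n : ℕ) (k : Fin D.K) (s : 𝒮) (d d' : Fin n → ℝ × ℝ × 𝒱) :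
    D.learner n k s (glue (D.foldSet n k s) d d') = D.learner n k s d :=
  D.learner_complement n k s _ _ fun i hi => by simp [glue, foldSet, hi]

/-- `foldError` times any function of the observation, at the argument required by
`RandomSample.lintegral_crossfit`. -/
theorem foldError_glue_smul {M : Type*} [AddCommGroup M] [Module ℝ M] (n : ℕ) (k : Fin D.K)
    (s : 𝒮) (d d' : Fin n → ℝ × ℝ × 𝒱) (i : Fin n) (F : ℝ × ℝ × 𝒱 → M) :
    D.foldError B n k s (glue (D.foldSet n k s) d d') i (glue (D.foldSet n k s) d d' i)
        • F (glue (D.foldSet n k s) d d' i)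
      = D.foldError B n k s d i (d' i) • F (d' i) := by
  by_cases h : D.fold n s i = k
  · have : glue (D.foldSet n k s) d d' i = d' i := by simp [glue, foldSet, h]
    rw [this, foldError, learner_glue, foldError]
  · simp [foldError, h]

theorem foldError_glue (n : ℕ) (k : Fin D.K) (s : 𝒮) (d d' : Fin n → ℝ × ℝ × 𝒱) (i : Fin n) :
    D.foldError B n k s (glue (D.foldSet n k s) d d') i (glue (D.foldSet n k s) d d' i)
      = D.foldError B n k s d i (d' i) := by
  simpa using foldError_glue_smul (B := B) n k s d d' i (fun _ => (1 : ℝ))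

theorem lintegral_covariate {f : 𝒱 → ℝ≥0∞} (hf : Measurable f) :
    ∫⁻ x, f x.2.2 ∂D.law μ = ∫⁻ v, f v ∂(μ.map (D.V 0)) := by
  rw [lintegral_law (f := fun x => f x.2.2) (hf.comp measurable_snd.snd),
    lintegral_map hf (D.measurable_V 0)]
  rfl

theorem measurable_learner_sub_section (hB : Measurable B) (n : ℕ) (k : Fin D.K) (s : 𝒮)
    (d : Fin n → ℝ × ℝ × 𝒱) : Measurable fun v => D.learner n k s d v - B v :=
  (measurable_learner_sub hB n k).comp
    (measurable_const.prodMk (measurable_const.prodMk measurable_id))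

theorem measurable_foldError_section (hB : Measurable B) (n : ℕ) (k : Fin D.K) (s : 𝒮)
    (d : Fin n → ℝ × ℝ × 𝒱) (i : Fin n) : Measurable (D.foldError B n k s d i) :=
  (measurable_foldError hB n k i).comp
    (measurable_const.prodMk (measurable_const.prodMk measurable_id))

theorem Overlap.lintegral_foldError_sq_le {ξ : ℝ} (h : D.Overlap μ ξ) (hB : Measurable B) (n : ℕ)
    (k : Fin D.K) (s : 𝒮) (d : Fin n → ℝ × ℝ × 𝒱) (i : Fin n) :
    ∫⁻ x, ENNReal.ofReal (D.foldError B n k s d i x ^ 2) ∂D.law μ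
      ≤ ENNReal.ofReal ((ξ ^ 2)⁻¹ ^ 2) * D.learnerError μ B n k s d := by
  have hm : Measurable fun v => ENNReal.ofReal ((D.learner n k s d v - B v) ^ 2) :=
    ((measurable_learner_sub_section hB n k s d).pow_const 2).ennreal_ofReal
  have hm2 : Measurable fun x : ℝ × ℝ × 𝒱 =>
      ENNReal.ofReal ((D.learner n k s d x.2.2 - B x.2.2) ^ 2) := hm.comp measurable_snd.snd
  rw [learnerError, ← lintegral_covariate hm, ← lintegral_const_mul _ hm2]
  refine lintegral_mono_ae ?_
  filter_upwards [h.abs_weight_le] with x hx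
  rw [← ENNReal.ofReal_mul (sq_nonneg _)]
  refine ENNReal.ofReal_le_ofReal ?_
  rw [foldError]
  split_ifs
  · rw [mul_pow, mul_comm]
    refine mul_le_mul_of_nonneg_right ?_ (sq_nonneg _)
    rw [← sq_abs]
    exact pow_le_pow_left₀ (abs_nonneg _) hx 2
  · rw [zero_pow two_ne_zero]
    positivity

/-- Conditionally on the seed and the training sample, the mean sum of the squared errors. -/
theorem Overlap.lintegral_sum_foldError_sq_le [IsProbabilityMeasure μ] {ξ : ℝ}
    (h : D.Overlap μ ξ) (hB : Measurable B) (n : ℕ)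
    (k : Fin D.K) (s : 𝒮) (d : Fin n → ℝ × ℝ × 𝒱) :
    ∫⁻ d', ∑ i, ENNReal.ofReal (D.foldError B n k s d i (d' i) ^ 2)
        ∂(Measure.pi fun _ => D.law μ)
      ≤ n * (ENNReal.ofReal ((ξ ^ 2)⁻¹ ^ 2) * D.learnerError μ B n k s d) := by
  have hm : ∀ i, Measurable fun x => ENNReal.ofReal (D.foldError B n k s d i x ^ 2) := fun i =>
    ((measurable_foldError_section hB n k s d i).pow_const 2).ennreal_ofReal
  have hm2 : ∀ i, Measurable fun d' : Fin n → ℝ × ℝ × 𝒱 =>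
      ENNReal.ofReal (D.foldError B n k s d i (d' i) ^ 2) := fun i =>
    (hm i).comp (measurable_pi_apply i)
  rw [lintegral_finsetSum _ fun i _ => hm2 i]
  calc _ ≤ ∑ _i : Fin n, ENNReal.ofReal ((ξ ^ 2)⁻¹ ^ 2) * D.learnerError μ B n k s d := by
        refine Finset.sum_le_sum fun i _ => ?_
        rw [(measurePreserving_coord (D.law μ) i).lintegral_comp (hm i)]
        exact h.lintegral_foldError_sq_le hB n k s d i
    _ = _ := by rw [Finset.sum_const, Finset.card_univ, Fintype.card_fin, nsmul_eq_mul]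

/-- Conditionally on the seed and the training sample, the score of the errors in a fold is a sum
of independent centered terms, because the weight is conditionally centered. -/
theorem Overlap.lintegral_norm_sum_foldError_le [IsProbabilityMeasure μ] {ξ C : ℝ}
    (h : D.Overlap μ ξ) (hb : D.BoundedRegressors μ C) (hB : Measurable B) {n : ℕ} (hn : 0 < n)
    (k : Fin D.K) (s : 𝒮) (d : Fin n → ℝ × ℝ × 𝒱) :
    ∫⁻ d' : Fin n → ℝ × ℝ × 𝒱, ‖∑ i, D.foldError B n k s d i (d' i) • D.φ n (d' i).2.2‖ₑ
        ∂(Measure.pi fun _ => D.law μ)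
      ≤ ENNReal.ofReal (n * (Real.sqrt 8 * C * (ξ ^ 2)⁻¹ * D.rate n))
        * D.learnerError μ B n k s d ^ (1 / 2 : ℝ) := by
  have hn' : (0 : ℝ) < n := by exact_mod_cast hn
  have hξ : 0 < (ξ ^ 2)⁻¹ := by have := h.1; positivity
  have hc : 0 < n * (Real.sqrt 8 * C * (ξ ^ 2)⁻¹ * D.rate n) := by
    have := hb.1
    have := rate_pos (D := D) hn
    positivity
  by_cases hfin : D.learnerError μ B n k s d = ∞
  · rw [hfin, ENNReal.top_rpow_of_pos (by norm_num),
      ENNReal.mul_top (ENNReal.ofReal_pos.mpr hc).ne']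
    exact le_top
  set l : 𝒱 → ℝ := fun v => D.learner n k s d v - B v with hl
  have hlm : Measurable l := measurable_learner_sub_section hB n k s d
  have hfm := measurable_foldError_section (D := D) hB n k s d
  have hlsq : Integrable (fun x : ℝ × ℝ × 𝒱 => l x.2.2 ^ 2) (D.law μ) := by
    refine (lintegral_ofReal_ne_top_iff_integrable (f := fun x : ℝ × ℝ × 𝒱 => l x.2.2 ^ 2)
      ((hlm.comp measurable_snd.snd).pow_const 2).aestronglyMeasurable
      (ae_of_all _ fun x => sq_nonneg _)).mp ?_
    rwa [lintegral_covariate (f := fun v => ENNReal.ofReal (l v ^ 2))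
      (hlm.pow_const 2).ennreal_ofReal]
  have hlL : MemLp (fun x : ℝ × ℝ × 𝒱 => l x.2.2) 2 (D.law μ) :=
    (memLp_two_iff_integrable_sq (hlm.comp measurable_snd.snd).aestronglyMeasurable).mpr hlsq
  have hL : ∀ i, MemLp (D.foldError B n k s d i) 2 (D.law μ) := fun i => by
    by_cases hi : D.fold n s i = k
    · refine (memLp_congr_ae (ae_of_all _ fun x => ?_)).mp (h.memLp_mul_weight hlL)
      simp [foldError, hi, hl]
    · refine (memLp_congr_ae (ae_of_all _ fun x => ?_)).mp (MemLp.zero (p := 2) (ε := ℝ))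
      simp [foldError, hi]
  have h0 : ∀ i j, ∫ x, D.φ n x.2.2 j * D.foldError B n k s d i x ∂D.law μ = 0 := fun i j => by
    by_cases hi : D.fold n s i = k
    · have hφ := measurable_regressor (D := D) n j
      have hint : Integrable (fun x : ℝ × ℝ × 𝒱 => D.φ n x.2.2 j * l x.2.2) (D.law μ) := by
        refine (hlL.integrable (by norm_num)).bdd_mul (c := C)
          (hφ.comp measurable_snd.snd).aestronglyMeasurable ?_
        filter_upwards [hb.norm_regressor_le n] with x hx
        exact (norm_le_pi_norm _ j).trans hx
      have := h.integral_mul_weight (g := fun v => D.φ n v j * l v) (hφ.mul hlm)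
        ((integrable_law_iff ((hφ.mul hlm).comp measurable_snd.snd)).mp hint)
      rw [← this]
      refine integral_congr_ae (ae_of_all _ fun x => ?_)
      simp [foldError, hi, hl, mul_assoc]
    · simp [foldError, hi]
  have hsq : ∀ i, ∫ x, D.foldError B n k s d i x ^ 2 ∂D.law μ
      ≤ (ξ ^ 2)⁻¹ ^ 2 * (D.learnerError μ B n k s d).toReal := fun i => by
    rw [integral_eq_lintegral_of_nonneg_ae (ae_of_all _ fun x => sq_nonneg _)
      ((hfm i).pow_const 2).aestronglyMeasurable]
    refine (ENNReal.toReal_mono (ENNReal.mul_ne_top ENNReal.ofReal_ne_top hfin)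
      (h.lintegral_foldError_sq_le hB n k s d i)).trans_eq ?_
    rw [ENNReal.toReal_mul, ENNReal.toReal_ofReal (sq_nonneg _)]
  obtain ⟨hi, hle⟩ := hb.integral_norm_sum_smul_le hL h0
  rw [← ofReal_integral_norm_eq_lintegral_enorm hi]
  have h2 : D.learnerError μ B n k s d ^ (1 / 2 : ℝ)
      = ENNReal.ofReal (Real.sqrt (D.learnerError μ B n k s d).toReal) := by
    rw [Real.sqrt_eq_rpow, ← ENNReal.ofReal_rpow_of_nonneg ENNReal.toReal_nonneg (by norm_num),
      ENNReal.ofReal_toReal hfin]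
  rw [h2, ← ENNReal.ofReal_mul hc.le]
  refine ENNReal.ofReal_le_ofReal (hle.trans ?_)
  have h3 : ∑ i : Fin n, C ^ 2 * ∫ x, D.foldError B n k s d i x ^ 2 ∂D.law μ
      ≤ n * ((C * (ξ ^ 2)⁻¹) ^ 2 * (D.learnerError μ B n k s d).toReal) := by
    calc _ ≤ ∑ _i : Fin n, (C * (ξ ^ 2)⁻¹) ^ 2 * (D.learnerError μ B n k s d).toReal := by
          refine Finset.sum_le_sum fun i _ => ?_
          rw [mul_pow, mul_assoc]
          exact mul_le_mul_of_nonneg_left (hsq i) (sq_nonneg _)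
      _ = _ := by rw [Finset.sum_const, Finset.card_univ, Fintype.card_fin, nsmul_eq_mul]
  refine (mul_le_mul_of_nonneg_left (Real.sqrt_le_sqrt h3) (Real.sqrt_nonneg _)).trans_eq ?_
  rw [sqrt_mul_sqrt_eq_rate hn (mul_nonneg hb.1.le hξ.le)]
  ring

/-- The mean squared error of the nuisance estimate for the fold `k`. -/
def nuisanceMSE (D : Setup Ω 𝒱 𝒮) (μ : Measure Ω) (B : 𝒱 → ℝ) (n : ℕ) (k : Fin D.K) : ℝ≥0∞ :=
  ∫⁻ ω, D.learnerError μ B n k (D.S ω) (D.sample n ω) ∂μ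

theorem measurable_learnerError [IsProbabilityMeasure μ] (hB : Measurable B) (n : ℕ)
    (k : Fin D.K) : Measurable fun ω => D.learnerError μ B n k (D.S ω) (D.sample n ω) := by
  have : IsProbabilityMeasure (μ.map (D.V 0)) :=
    Measure.isProbabilityMeasure_map (D.measurable_V 0).aemeasurable
  exact Measurable.lintegral_prod_right'
    (f := fun q : Ω × 𝒱 => ENNReal.ofReal
      ((D.learner n k (D.S q.1) (D.sample n q.1) q.2 - B q.2) ^ 2))
    ((((measurable_learner_sub hB n k).comp ((D.measurable_S.comp measurable_fst).prodMk
      (((measurable_sample n).comp measurable_fst).prodMk measurable_snd))).pow_const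
      2).ennreal_ofReal)

theorem lintegral_sqrt_le [IsProbabilityMeasure μ] {f : Ω → ℝ≥0∞} (hf : Measurable f) :
    ∫⁻ ω, f ω ^ (1 / 2 : ℝ) ∂μ ≤ (∫⁻ ω, f ω ∂μ) ^ (1 / 2 : ℝ) := by
  have := ENNReal.lintegral_mul_le_Lp_mul_Lq μ Real.HolderConjugate.two_two
    (hf.pow_const (1 / 2 : ℝ)).aemeasurable (measurable_const (a := (1 : ℝ≥0∞))).aemeasurable
  have h2 : ∀ ω, (f ω ^ (1 / 2 : ℝ)) ^ (2 : ℝ) = f ω := fun ω => by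
    rw [← ENNReal.rpow_mul]
    norm_num
  simpa only [h2, Pi.mul_apply, mul_one, ENNReal.one_rpow, lintegral_const, measure_univ] using this

/-- The mean empirical square of the nuisance error. -/
theorem RandomSample.lintegral_avg_nuisanceError_sq_le [IsProbabilityMeasure μ] {ξ : ℝ}
    (hs : D.RandomSample μ) (h : D.Overlap μ ξ) (hB : Measurable B) {n : ℕ} (hn : 0 < n) :
    ∫⁻ ω, ENNReal.ofReal (1 / (n : ℝ) * ∑ i, D.nuisanceError B n ω i ^ 2) ∂μ
      ≤ ENNReal.ofReal ((ξ ^ 2)⁻¹ ^ 2) * ∑ k, D.nuisanceMSE μ B n k := by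
  have hn' : (0 : ℝ) < n := by exact_mod_cast hn
  have hmk : ∀ k, Measurable fun q : 𝒮 × (Fin n → ℝ × ℝ × 𝒱) × (Fin n → ℝ × ℝ × 𝒱) =>
      ∑ i, ENNReal.ofReal (D.foldError B n k q.1 q.2.1 i (q.2.2 i) ^ 2) := fun k =>
    Finset.measurable_fun_sum _ fun i _ =>
      ((measurable_foldError_diag hB n k i).pow_const 2).ennreal_ofReal
  have e1 : ∀ ω, ENNReal.ofReal (1 / (n : ℝ) * ∑ i, D.nuisanceError B n ω i ^ 2)
      = ENNReal.ofReal (1 / (n : ℝ)) * ∑ k, ∑ i, ENNReal.ofReal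
        (D.foldError B n k (D.S ω) (D.sample n ω) i (D.sample n ω i) ^ 2) := fun ω => by
    rw [ENNReal.ofReal_mul (by positivity),
      ENNReal.ofReal_sum_of_nonneg fun i _ => sq_nonneg _, Finset.sum_comm]
    congr 1
    refine Finset.sum_congr rfl fun i _ => ?_
    rw [nuisanceError_sq_eq_sum, ENNReal.ofReal_sum_of_nonneg fun i _ => sq_nonneg _]
  have hdiag : ∀ k, Measurable fun ω => ∑ i, ENNReal.ofReal
        (D.foldError B n k (D.S ω) (D.sample n ω) i (D.sample n ω i) ^ 2) := fun k => by
    have := (hmk k).comp (measurable_seed_sample_sample (D := D) n)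
    exact this
  simp only [e1]
  rw [lintegral_const_mul _ (Finset.measurable_fun_sum _ fun k _ => hdiag k),
    lintegral_finsetSum _ fun k _ => hdiag k]
  have e2 : ∀ k, ∫⁻ ω, ∑ i, ENNReal.ofReal
        (D.foldError B n k (D.S ω) (D.sample n ω) i (D.sample n ω i) ^ 2) ∂μ
      ≤ n * (ENNReal.ofReal ((ξ ^ 2)⁻¹ ^ 2) * D.nuisanceMSE μ B n k) := fun k => by
    rw [hs.lintegral_crossfit k (Ψ := fun s d d' =>
      ∑ i, ENNReal.ofReal (D.foldError B n k s d i (d' i) ^ 2)) (hmk k)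
      fun s d d' => by simp only [foldError_glue]]
    refine (lintegral_mono fun ω => h.lintegral_sum_foldError_sq_le hB n k _ _).trans_eq ?_
    rw [lintegral_const_mul _ ((measurable_learnerError hB n k).const_mul _),
      lintegral_const_mul _ (measurable_learnerError hB n k), nuisanceMSE]
  refine (mul_le_mul_right (Finset.sum_le_sum fun k _ => e2 k) _).trans_eq ?_
  rw [← Finset.mul_sum, ← Finset.mul_sum, ← mul_assoc, ← ENNReal.ofReal_natCast n,
    ← ENNReal.ofReal_mul (by positivity), one_div_mul_cancel hn'.ne', ENNReal.ofReal_one, one_mul]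

/-- The mean sup norm of the score of the nuisance error is of smaller order than the rate. -/
theorem RandomSample.lintegral_norm_score_nuisanceError_le [IsProbabilityMeasure μ] {ξ C : ℝ}
    (hs : D.RandomSample μ) (h : D.Overlap μ ξ) (hb : D.BoundedRegressors μ C)
    (hB : Measurable B) {n : ℕ} (hn : 0 < n) :
    ∫⁻ ω, ‖(1 / (n : ℝ)) • ((D.Xmat n ω)ᵀ *ᵥ D.nuisanceError B n ω)‖ₑ ∂μ
      ≤ ENNReal.ofReal (Real.sqrt 8 * C * (ξ ^ 2)⁻¹ * D.rate n)
        * ∑ k, D.nuisanceMSE μ B n k ^ (1 / 2 : ℝ) := by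
  have hn' : (0 : ℝ) < n := by exact_mod_cast hn
  have hmk : ∀ k, Measurable fun q : 𝒮 × (Fin n → ℝ × ℝ × 𝒱) × (Fin n → ℝ × ℝ × 𝒱) =>
      ‖∑ i, D.foldError B n k q.1 q.2.1 i (q.2.2 i) • D.φ n (q.2.2 i).2.2‖ₑ := fun k =>
    (Finset.measurable_fun_sum _ fun i _ => (measurable_foldError_diag hB n k i).smul
      ((D.measurable_φ n).comp ((measurable_pi_apply i).comp measurable_snd.snd).snd.snd)).enorm
  have hdiag : ∀ k, Measurable fun ω => ‖∑ i, D.foldError B n k (D.S ω) (D.sample n ω) i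
      (D.sample n ω i) • D.φ n (D.sample n ω i).2.2‖ₑ := fun k => by
    have := (hmk k).comp (measurable_seed_sample_sample (D := D) n)
    exact this
  have e1 : ∀ ω, ‖(1 / (n : ℝ)) • ((D.Xmat n ω)ᵀ *ᵥ D.nuisanceError B n ω)‖ₑ
      ≤ ENNReal.ofReal (1 / (n : ℝ)) * ∑ k, ‖∑ i, D.foldError B n k (D.S ω) (D.sample n ω) i
        (D.sample n ω i) • D.φ n (D.sample n ω i).2.2‖ₑ := fun ω => by
    rw [enorm_smul, Real.enorm_eq_ofReal (by positivity), transpose_mulVec_eq_sum]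
    refine mul_le_mul_right ?_ _
    simp only [nuisanceError_eq_sum, Finset.sum_smul]
    rw [Finset.sum_comm]
    exact enorm_sum_le _ _
  refine (lintegral_mono e1).trans ?_
  rw [lintegral_const_mul _ (Finset.measurable_fun_sum _ fun k _ => hdiag k),
    lintegral_finsetSum _ fun k _ => hdiag k]
  have e2 : ∀ k, ∫⁻ ω, ‖∑ i, D.foldError B n k (D.S ω) (D.sample n ω) i
        (D.sample n ω i) • D.φ n (D.sample n ω i).2.2‖ₑ ∂μ
      ≤ ENNReal.ofReal (n * (Real.sqrt 8 * C * (ξ ^ 2)⁻¹ * D.rate n))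
        * D.nuisanceMSE μ B n k ^ (1 / 2 : ℝ) := fun k => by
    rw [hs.lintegral_crossfit k (Ψ := fun s d d' =>
      ‖∑ i, D.foldError B n k s d i (d' i) • D.φ n (d' i).2.2‖ₑ) (hmk k)
      fun s d d' => by
        simp only [foldError_glue_smul (B := B) n k s d d' _ (fun x => D.φ n x.2.2)]]
    refine (lintegral_mono fun ω =>
      h.lintegral_norm_sum_foldError_le hb hB hn k _ _).trans ?_
    rw [lintegral_const_mul _ ((measurable_learnerError hB n k).pow_const _)]
    exact mul_le_mul_right (lintegral_sqrt_le (measurable_learnerError hB n k)) _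
  refine (mul_le_mul_right (Finset.sum_le_sum fun k _ => e2 k) _).trans_eq ?_
  rw [← Finset.mul_sum, ← mul_assoc, ← ENNReal.ofReal_mul (by positivity), ← mul_assoc,
    one_div_mul_cancel hn'.ne', one_mul]

end Setup

/-! ### Deterministic bound of the nuisance-estimation term -/

theorem quadForm_ge {n : ℕ} {A : Matrix (Fin n) (Fin 2) ℝ} {S : Matrix (Fin 2) (Fin 2) ℝ}
    {c : ℝ} (hS : ∀ g : Fin 2 → ℝ, 4 * c * (g 0 ^ 2 + g 1 ^ 2)
      ≤ S 0 0 * g 0 ^ 2 + 2 * S 0 1 * g 0 * g 1 + S 1 1 * g 1 ^ 2)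
    (hA : ∀ a b, |1 / (n : ℝ) * ∑ i, A i a * A i b - S a b| ≤ c) (g : Fin 2 → ℝ) :
    2 * c * (g 0 ^ 2 + g 1 ^ 2) ≤ 1 / (n : ℝ) * ∑ i, (A *ᵥ g) i ^ 2 := by
  have e1 : 1 / (n : ℝ) * ∑ i, (A *ᵥ g) i ^ 2
      = (1 / (n : ℝ) * ∑ i, A i 0 * A i 0) * g 0 ^ 2
        + 2 * (1 / (n : ℝ) * ∑ i, A i 0 * A i 1) * (g 0 * g 1)
        + (1 / (n : ℝ) * ∑ i, A i 1 * A i 1) * g 1 ^ 2 := by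
    simp only [Matrix.mulVec, dotProduct, Fin.sum_univ_two, Finset.mul_sum, Finset.sum_mul,
      ← Finset.sum_add_distrib]
    exact Finset.sum_congr rfl fun i _ => by ring
  rw [e1]
  obtain ⟨h1, -⟩ := abs_le.mp (hA 0 0)
  obtain ⟨h2, -⟩ := abs_le.mp (hA 1 1)
  have h3 := hA 0 1
  set a := 1 / (n : ℝ) * ∑ i, A i 0 * A i 0
  set b := 1 / (n : ℝ) * ∑ i, A i 0 * A i 1
  set d := 1 / (n : ℝ) * ∑ i, A i 1 * A i 1
  have h4 : -(c * (g 0 ^ 2 + g 1 ^ 2)) ≤ 2 * (b - S 0 1) * (g 0 * g 1) := by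
    have h5 : |2 * (b - S 0 1) * (g 0 * g 1)| ≤ c * (g 0 ^ 2 + g 1 ^ 2) := by
      rw [show 2 * (b - S 0 1) * (g 0 * g 1) = (b - S 0 1) * (2 * (g 0 * g 1)) by ring, abs_mul]
      refine mul_le_mul h3 ?_ (abs_nonneg _) ((abs_nonneg _).trans h3)
      rw [abs_le]
      constructor <;> nlinarith [sq_nonneg (g 0 + g 1), sq_nonneg (g 0 - g 1)]
    exact (abs_le.mp h5).1
  nlinarith [hS g, mul_le_mul_of_nonneg_right h1 (sq_nonneg (g 0)),
    mul_le_mul_of_nonneg_right h2 (sq_nonneg (g 1))]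

/-- The nuisance-estimation term is small when the perturbation `δ` of the second column of `A` has
small empirical norm `t` and small score `t r`, when `y` is almost uncorrelated with `A`, and when
the scores of the columns of `A` are of order `r`. The term equals
`n⁻¹ X'(P q - γ₁ δ)` with `q = γ₁ δ - y`, and `P q` has small coefficients by `abs_coeff_le`. -/
theorem norm_remainder_le {n p : ℕ} {X : Matrix (Fin n) (Fin p) ℝ}
    {A A' : Matrix (Fin n) (Fin 2) ℝ} {y δ : Fin n → ℝ} {γ : Fin 2 → ℝ} {c t a m r : ℝ}
    (hc : 0 < c) (ht : 0 ≤ t) (ht1 : t ≤ 1) (htc : t ^ 2 ≤ c / 4) (ha : 0 ≤ a) (hr : 0 ≤ r)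
    (h0 : ∀ i, A' i 0 = A i 0) (h1 : ∀ i, A' i 1 = A i 1 + δ i)
    (hA : ∀ g : Fin 2 → ℝ, c * (g 0 ^ 2 + g 1 ^ 2) ≤ 1 / (n : ℝ) * ∑ i, (A *ᵥ g) i ^ 2)
    (hAa : ∀ b, 1 / (n : ℝ) * ∑ i, A i b ^ 2 ≤ a ^ 2)
    (hya : 1 / (n : ℝ) * ∑ i, y i ^ 2 ≤ a ^ 2)
    (hδ : 1 / (n : ℝ) * ∑ i, δ i ^ 2 ≤ t ^ 2)
    (hAy : ∀ b, |1 / (n : ℝ) * ∑ i, A i b * y i| ≤ t)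
    (hXA : ∀ b, ‖(1 / (n : ℝ)) • (Xᵀ *ᵥ fun i => A i b)‖ ≤ m * r)
    (hXδ : ‖(1 / (n : ℝ)) • (Xᵀ *ᵥ δ)‖ ≤ t * r) :
    ‖(1 / (n : ℝ)) • (Xᵀ *ᵥ (A *ᵥ γ - colProj A' (A *ᵥ γ)))
        - (1 / (n : ℝ)) • (Xᵀ *ᵥ colProj A' y)‖
      ≤ t * (|γ 1| + (m + 1) * (8 * (|γ 1| * (a + 1) + 1 + a) / c)) * r := by
  have hA' : A' *ᵥ γ = A *ᵥ γ + γ 1 • δ := by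
    ext i
    simp only [Matrix.mulVec, dotProduct, Fin.sum_univ_two, h0, h1, Pi.add_apply, Pi.smul_apply,
      smul_eq_mul]
    ring
  set q : Fin n → ℝ := γ 1 • δ - y with hq
  obtain ⟨g, hg⟩ := exists_mulVec_eq_colProj A' q
  have hPq : colProj A' q = A' *ᵥ γ - colProj A' (A *ᵥ γ) - colProj A' y := by
    rw [← colProj_mulVec A' γ, ← colProj_sub, ← colProj_sub, hq, hA',
      add_sub_cancel_left]
  have hAg : A' *ᵥ g = g 0 • (fun i => A i 0) + g 1 • (fun i => A i 1) + g 1 • δ := by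
    ext i
    simp only [Matrix.mulVec, dotProduct, Fin.sum_univ_two, h0, h1, Pi.add_apply, Pi.smul_apply,
      smul_eq_mul]
    ring
  have hrem : (1 / (n : ℝ)) • (Xᵀ *ᵥ (A *ᵥ γ - colProj A' (A *ᵥ γ)))
        - (1 / (n : ℝ)) • (Xᵀ *ᵥ colProj A' y)
      = g 0 • ((1 / (n : ℝ)) • (Xᵀ *ᵥ fun i => A i 0))
        + g 1 • ((1 / (n : ℝ)) • (Xᵀ *ᵥ fun i => A i 1))
        + g 1 • ((1 / (n : ℝ)) • (Xᵀ *ᵥ δ)) - γ 1 • ((1 / (n : ℝ)) • (Xᵀ *ᵥ δ)) := by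
    rw [← smul_sub, ← Matrix.mulVec_sub]
    have : A *ᵥ γ - colProj A' (A *ᵥ γ) - colProj A' y
        = g 0 • (fun i => A i 0) + g 1 • (fun i => A i 1) + g 1 • δ - γ 1 • δ := by
      rw [← hAg, hg, hPq, hA']
      abel
    rw [this]
    simp only [Matrix.mulVec_sub, Matrix.mulVec_add, Matrix.mulVec_smul, smul_sub, smul_add]
    simp only [smul_comm (1 / (n : ℝ))]
  have havg : ∀ (f₁ f₂ : Fin n → ℝ) (s : ℝ), 1 / (n : ℝ) * ∑ i, (s * f₁ i - f₂ i)
      = s * (1 / (n : ℝ) * ∑ i, f₁ i) - 1 / (n : ℝ) * ∑ i, f₂ i := fun f₁ f₂ s => by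
    rw [Finset.sum_sub_distrib, ← Finset.mul_sum]
    ring
  have hAδ : ∀ b, |1 / (n : ℝ) * ∑ i, A i b * δ i| ≤ a * t := fun b =>
    abs_avg_mul_le ha ht (hAa b) hδ
  have hδδ : |1 / (n : ℝ) * ∑ i, δ i * δ i| ≤ t * t := abs_avg_mul_le ht ht hδ hδ
  have hδy : |1 / (n : ℝ) * ∑ i, δ i * y i| ≤ t * a := abs_avg_mul_le ht ha hδ hya
  have hcoef : ∀ b, |1 / (n : ℝ) * ∑ i, A' i b * q i| ≤ t * (|γ 1| * (a + 1) + 1 + a) := by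
    rw [Fin.forall_fin_two]
    constructor
    · have e : 1 / (n : ℝ) * ∑ i, A' i 0 * q i
          = γ 1 * (1 / (n : ℝ) * ∑ i, A i 0 * δ i) - 1 / (n : ℝ) * ∑ i, A i 0 * y i := by
        rw [← havg]
        congr 1
        exact Finset.sum_congr rfl fun i _ => by
          simp only [h0, hq, Pi.sub_apply, Pi.smul_apply, smul_eq_mul]; ring
      rw [e]
      refine (abs_sub _ _).trans ?_
      rw [abs_mul (γ 1)]
      nlinarith [mul_le_mul_of_nonneg_left (hAδ 0) (abs_nonneg (γ 1)), hAy 0, abs_nonneg (γ 1),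
        mul_nonneg (abs_nonneg (γ 1)) ht, mul_nonneg ht ha]
    · have e : 1 / (n : ℝ) * ∑ i, A' i 1 * q i
          = γ 1 * (1 / (n : ℝ) * ∑ i, A i 1 * δ i) - 1 / (n : ℝ) * ∑ i, A i 1 * y i
            + (γ 1 * (1 / (n : ℝ) * ∑ i, δ i * δ i) - 1 / (n : ℝ) * ∑ i, δ i * y i) := by
        rw [← havg, ← havg, ← mul_add, ← Finset.sum_add_distrib]
        congr 1
        exact Finset.sum_congr rfl fun i _ => by
          simp only [h1, hq, Pi.sub_apply, Pi.smul_apply, smul_eq_mul]; ring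
      rw [e]
      refine (abs_add_le _ _).trans ((add_le_add (abs_sub _ _) (abs_sub _ _)).trans ?_)
      rw [abs_mul (γ 1), abs_mul (γ 1)]
      have := mul_le_mul_of_nonneg_left hδδ (abs_nonneg (γ 1))
      have h2 : t * t ≤ t := mul_le_of_le_one_right ht ht1
      have := mul_le_mul_of_nonneg_left h2 (abs_nonneg (γ 1))
      have := mul_le_mul_of_nonneg_left (hAδ 1) (abs_nonneg (γ 1))
      have := hAy 1
      nlinarith
  have hl : 0 ≤ |γ 1| * (a + 1) + 1 + a := by positivity
  have hsmall := abs_coeff_le hc (mul_nonneg ht hl) h0 h1 (hA g) (hδ.trans htc) hcoef hg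
  have hm : 0 ≤ m * r := (norm_nonneg _).trans (hXA 0)
  rw [hrem]
  calc _ ≤ |g 0| * (m * r) + |g 1| * (m * r) + |g 1| * (t * r) + |γ 1| * (t * r) := by
        refine (norm_sub_le _ _).trans (add_le_add ((norm_add_le _ _).trans (add_le_add
          ((norm_add_le _ _).trans (add_le_add ?_ ?_)) ?_)) ?_) <;>
        rw [norm_smul, Real.norm_eq_abs] <;>
        refine mul_le_mul_of_nonneg_left ?_ (abs_nonneg _)
        exacts [hXA 0, hXA 1, hXδ, hXδ]
    _ ≤ (|g 0| + |g 1|) * (m * r + r) + |γ 1| * (t * r) := by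
        have h2 : t * r ≤ r := mul_le_of_le_one_left hr ht1
        have := mul_le_mul_of_nonneg_left h2 (abs_nonneg (g 1))
        have := mul_nonneg (abs_nonneg (g 0)) hr
        nlinarith
    _ ≤ 8 * (t * (|γ 1| * (a + 1) + 1 + a)) / c * (m * r + r) + |γ 1| * (t * r) := by
        have := mul_le_mul_of_nonneg_right hsmall (add_nonneg hm hr)
        linarith
    _ = _ := by ring

/-- If a `2 × 2` quadratic form is nonnegative and has nonzero determinant,
then it is bounded below by a positive multiple of the Euclidean norm. -/
theorem exists_quadForm_ge {a b d : ℝ} (h : ∀ x y : ℝ, 0 ≤ a * x ^ 2 + 2 * b * x * y + d * y ^ 2)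
    (hdet : a * d - b * b ≠ 0) :
    ∃ c : ℝ, 0 < c ∧ ∀ x y : ℝ,
      4 * c * (x ^ 2 + y ^ 2) ≤ a * x ^ 2 + 2 * b * x * y + d * y ^ 2 := by
  have ha : 0 ≤ a := by simpa using h 1 0
  have hd : 0 ≤ d := by simpa using h 0 1
  have hpos : 0 < a * d - b * b := by
    refine lt_of_le_of_ne (not_lt.mp fun hneg => ?_) hdet.symm
    have h1 : a * (a * d - b * b) ≥ 0 := by nlinarith [h (-b) a]
    have h2 : d * (a * d - b * b) ≥ 0 := by nlinarith [h d (-b)]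
    have ha0 : a = 0 := le_antisymm (by nlinarith) ha
    have hd0 : d = 0 := le_antisymm (by nlinarith) hd
    have h3 := h 1 (-b)
    subst ha0 hd0
    nlinarith
  have htr : 0 < a + d := by
    by_contra hcon
    have ha0 : a = 0 := by linarith
    have hd0 : d = 0 := by linarith
    subst ha0 hd0
    nlinarith [mul_self_nonneg b]
  refine ⟨(a * d - b * b) / (a + d) / 4, by positivity, fun x y => ?_⟩
  have h1 := det_mul_le_trace_mul a b d x y
  have h2 : 4 * ((a * d - b * b) / (a + d) / 4) * (x ^ 2 + y ^ 2)
      = (a * d - b * b) * (x ^ 2 + y ^ 2) / (a + d) := by ring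
  rw [h2, div_le_iff₀ htr]
  linarith [sq b]

namespace Setup

variable {Ω 𝒱 𝒮 : Type*} [MeasurableSpace Ω] [MeasurableSpace 𝒱] [MeasurableSpace 𝒮]
  {D : Setup Ω 𝒱 𝒮} {μ : Measure Ω} {B : 𝒱 → ℝ}

/-! ### Moments of the denoised error -/

/-- The vector `Z = (W, B(V) W)` as a function of the observation. -/
def zvec (D : Setup Ω 𝒱 𝒮) (B : 𝒱 → ℝ) (x : ℝ × ℝ × 𝒱) : Fin 2 → ℝ :=
  ![D.weight x, B x.2.2 * D.weight x]

/-- `Y* = Y W - Z'γ` as a function of the observation. -/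
def ystar (D : Setup Ω 𝒱 𝒮) (μ : Measure Ω) (B : 𝒱 → ℝ) (x : ℝ × ℝ × 𝒱) : ℝ :=
  x.1 * D.weight x - D.zvec B x ⬝ᵥ D.gam μ B

/-- The denoised error `u = e - Z'γ` as a function of the observation. -/
def denoisedError (D : Setup Ω 𝒱 𝒮) (μ : Measure Ω) (B : 𝒱 → ℝ)
    (β : (n : ℕ) → Fin (D.p n) → ℝ) (n : ℕ) (x : ℝ × ℝ × 𝒱) : ℝ :=
  D.error β n x - D.zvec B x ⬝ᵥ D.gam μ B

theorem measurable_zvec (hB : Measurable B) (a : Fin 2) : Measurable fun x => D.zvec B x a := by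
  fin_cases a
  · exact measurable_weight
  · exact (hB.comp measurable_snd.snd).mul measurable_weight

theorem measurable_zvec_dotProduct (hB : Measurable B) (g : Fin 2 → ℝ) :
    Measurable fun x => D.zvec B x ⬝ᵥ g := by
  simp only [dotProduct]
  exact Finset.measurable_fun_sum _ fun a _ => (measurable_zvec hB a).mul_const _

theorem measurable_ystar (hB : Measurable B) : Measurable (D.ystar μ B) :=
  (measurable_fst.mul measurable_weight).sub (measurable_zvec_dotProduct hB _)

theorem measurable_denoisedError (hB : Measurable B) (β : (n : ℕ) → Fin (D.p n) → ℝ) (n : ℕ) :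
    Measurable (D.denoisedError μ B β n) :=
  (measurable_error β n).sub (measurable_zvec_dotProduct hB _)

theorem memLp_zvec [IsProbabilityMeasure μ] {ξ : ℝ} (ho : D.Overlap μ ξ) (hB : Measurable B)
    (hB2 : MemLp (fun ω => B (D.V 0 ω)) 2 μ) (a : Fin 2) :
    MemLp (fun x => D.zvec B x a) 2 (D.law μ) := by
  fin_cases a
  · refine (memLp_congr_ae (ae_of_all _ fun x => ?_)).mp
      (ho.memLp_mul_weight (f := fun _ => 1) (memLp_const 1))
    simp [zvec]
  · exact ho.memLp_mul_weight (f := fun x => B x.2.2)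
      ((memLp_law_iff (f := fun x => B x.2.2) (hB.comp measurable_snd.snd)).mpr hB2)

theorem memLp_zvec_dotProduct [IsProbabilityMeasure μ] {ξ : ℝ} (ho : D.Overlap μ ξ)
    (hB : Measurable B) (hB2 : MemLp (fun ω => B (D.V 0 ω)) 2 μ) (g : Fin 2 → ℝ) :
    MemLp (fun x => D.zvec B x ⬝ᵥ g) 2 (D.law μ) := by
  have h : ∀ a, MemLp (fun x => D.zvec B x a * g a) 2 (D.law μ) := fun a =>
    (memLp_congr_ae (ae_of_all _ fun x => mul_comm _ _)).mp
      ((memLp_zvec ho hB hB2 a).const_mul (g a))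
  exact memLp_finsetSum (p := 2) Finset.univ fun a _ => h a

theorem memLp_error {β : (n : ℕ) → Fin (D.p n) → ℝ} {n : ℕ} (he : MemLp (D.e β n 0) 2 μ) :
    MemLp (D.error β n) 2 (D.law μ) :=
  (memLp_law_iff (measurable_error β n)).mpr he

theorem memLp_denoisedError [IsProbabilityMeasure μ] {ξ : ℝ} (ho : D.Overlap μ ξ)
    (hB : Measurable B) (hB2 : MemLp (fun ω => B (D.V 0 ω)) 2 μ)
    {β : (n : ℕ) → Fin (D.p n) → ℝ} {n : ℕ} (he : MemLp (D.e β n 0) 2 μ) :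
    MemLp (D.denoisedError μ B β n) 2 (D.law μ) :=
  (memLp_error he).sub (memLp_zvec_dotProduct ho hB hB2 _)

theorem memLp_outcome_mul_weight [IsProbabilityMeasure μ] {C : ℝ} (hb : D.BoundedRegressors μ C)
    {β : (n : ℕ) → Fin (D.p n) → ℝ} {n : ℕ} (he : MemLp (D.e β n 0) 2 μ) :
    MemLp (fun x => x.1 * D.weight x) 2 (D.law μ) := by
  refine (memLp_congr_ae (ae_of_all _ fun x => ?_)).mp
    ((memLp_error he).add (hb.memLp_dotProduct n (β n)))
  simp [error]

theorem memLp_ystar [IsProbabilityMeasure μ] {ξ C : ℝ} (ho : D.Overlap μ ξ)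
    (hb : D.BoundedRegressors μ C) (hB : Measurable B)
    (hB2 : MemLp (fun ω => B (D.V 0 ω)) 2 μ)
    {β : (n : ℕ) → Fin (D.p n) → ℝ} {n : ℕ} (he : MemLp (D.e β n 0) 2 μ) :
    MemLp (D.ystar μ B) 2 (D.law μ) :=
  (memLp_outcome_mul_weight hb he).sub (memLp_zvec_dotProduct ho hB hB2 _)

/-- The regressors are uncorrelated with `Z`, because the weight is conditionally centered. -/
theorem integral_regressor_mul_zvec [IsProbabilityMeasure μ] {ξ C : ℝ} (ho : D.Overlap μ ξ)
    (hb : D.BoundedRegressors μ C) (hB : Measurable B)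
    (hB2 : MemLp (fun ω => B (D.V 0 ω)) 2 μ) (n : ℕ) (j : Fin (D.p n)) (a : Fin 2) :
    ∫ x, D.φ n x.2.2 j * D.zvec B x a ∂D.law μ = 0 := by
  have hφ := measurable_regressor (D := D) n j
  have hφb : ∀ᵐ ω ∂μ, ‖D.φ n (D.V 0 ω) j‖ ≤ C := hb.2 n j
  have hφm := (hφ.comp (D.measurable_V 0)).aestronglyMeasurable (μ := μ)
  fin_cases a
  · exact ho.integral_mul_weight hφ ((integrable_const C).mono' hφm hφb)
  · rw [← ho.integral_mul_weight (g := fun v => D.φ n v j * B v) (hφ.mul hB)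
      ((hB2.integrable (by norm_num)).bdd_mul hφm hφb)]
    refine integral_congr_ae (ae_of_all _ fun x => ?_)
    simp [zvec, mul_assoc]

theorem integral_regressor_mul_denoisedError [IsProbabilityMeasure μ] {ξ C : ℝ}
    (ho : D.Overlap μ ξ) (hb : D.BoundedRegressors μ C) (hB : Measurable B)
    (hB2 : MemLp (fun ω => B (D.V 0 ω)) 2 μ) {β : (n : ℕ) → Fin (D.p n) → ℝ}
    (hm : D.LinearModel μ β) {n : ℕ} (he : MemLp (D.e β n 0) 2 μ) (j : Fin (D.p n)) :
    ∫ x, D.φ n x.2.2 j * D.denoisedError μ B β n x ∂D.law μ = 0 := by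
  have hφm : AEStronglyMeasurable (fun x : ℝ × ℝ × 𝒱 => D.φ n x.2.2 j) (D.law μ) :=
    ((measurable_regressor n j).comp measurable_snd.snd).aestronglyMeasurable
  have hφb : ∀ᵐ x ∂D.law μ, ‖D.φ n x.2.2 j‖ ≤ C := by
    filter_upwards [hb.norm_regressor_le n] with x hx
    exact (norm_le_pi_norm _ j).trans hx
  have hi : ∀ {f : ℝ × ℝ × 𝒱 → ℝ}, MemLp f 2 (D.law μ) →
      Integrable (fun x => D.φ n x.2.2 j * f x) (D.law μ) := fun hf =>
    (hf.integrable (by norm_num)).bdd_mul hφm hφb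
  have hz := memLp_zvec (D := D) ho hB hB2
  have e1 : ∀ x, D.φ n x.2.2 j * D.denoisedError μ B β n x
      = D.φ n x.2.2 j * D.error β n x - (D.gam μ B 0 * (D.φ n x.2.2 j * D.zvec B x 0)
        + D.gam μ B 1 * (D.φ n x.2.2 j * D.zvec B x 1)) := fun x => by
    simp only [denoisedError, dotProduct, Fin.sum_univ_two]
    ring
  have hadd : Integrable (fun x => D.gam μ B 0 * (D.φ n x.2.2 j * D.zvec B x 0)
      + D.gam μ B 1 * (D.φ n x.2.2 j * D.zvec B x 1)) (D.law μ) :=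
    ((hi (hz 0)).const_mul _).add ((hi (hz 1)).const_mul _)
  simp only [e1]
  rw [integral_sub (hi (memLp_error he)) hadd,
    integral_add ((hi (hz 0)).const_mul _) ((hi (hz 1)).const_mul _), integral_const_mul,
    integral_const_mul, hm.integral_regressor_mul_error hb he,
    integral_regressor_mul_zvec ho hb hB hB2, integral_regressor_mul_zvec ho hb hB hB2]
  ring

theorem secondMomentZ_apply (hB : Measurable B) (a b : Fin 2) :
    D.secondMomentZ μ B a b = ∫ x, D.zvec B x a * D.zvec B x b ∂D.law μ :=
  (integral_law (f := fun x => D.zvec B x a * D.zvec B x b)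
    ((measurable_zvec hB a).mul (measurable_zvec hB b))).symm

/-- `Y*` is the residual of the population regression of `Y W` on `Z`. -/
theorem integral_zvec_mul_ystar [IsProbabilityMeasure μ] {ξ C : ℝ} (ho : D.Overlap μ ξ)
    (hb : D.BoundedRegressors μ C) (hB : Measurable B)
    (hB2 : MemLp (fun ω => B (D.V 0 ω)) 2 μ) {β : (n : ℕ) → Fin (D.p n) → ℝ} {n : ℕ}
    (he : MemLp (D.e β n 0) 2 μ) (hdet : (D.secondMomentZ μ B).det ≠ 0) (a : Fin 2) :
    ∫ x, D.zvec B x a * D.ystar μ B x ∂D.law μ = 0 := by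
  have hz := memLp_zvec (D := D) ho hB hB2
  have hyw := memLp_outcome_mul_weight hb he
  have e1 : ∀ x, D.zvec B x a * D.ystar μ B x
      = D.zvec B x a * (x.1 * D.weight x) - (D.zvec B x a * D.zvec B x 0 * D.gam μ B 0
        + D.zvec B x a * D.zvec B x 1 * D.gam μ B 1) := fun x => by
    simp only [ystar, dotProduct, Fin.sum_univ_two]
    ring
  have hi : ∀ b, Integrable (fun x => D.zvec B x a * D.zvec B x b * D.gam μ B b) (D.law μ) :=
    fun b => ((hz a).integrable_mul (hz b)).mul_const _
  have hadd : Integrable (fun x => D.zvec B x a * D.zvec B x 0 * D.gam μ B 0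
      + D.zvec B x a * D.zvec B x 1 * D.gam μ B 1) (D.law μ) := (hi 0).add (hi 1)
  have hzy : Integrable (fun x => D.zvec B x a * (x.1 * D.weight x)) (D.law μ) :=
    (hz a).integrable_mul hyw
  simp only [e1]
  rw [integral_sub hzy hadd, integral_add (hi 0) (hi 1),
    integral_mul_const, integral_mul_const, ← secondMomentZ_apply hB, ← secondMomentZ_apply hB]
  have h1 : D.secondMomentZ μ B *ᵥ D.gam μ B
      = fun a => ∫ ω, D.Z B 0 ω a * D.YW 0 ω ∂μ := by
    rw [gam, Matrix.mulVec_mulVec, Matrix.mul_nonsing_inv _ (isUnit_iff_ne_zero.mpr hdet),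
      Matrix.one_mulVec]
  have h2 := congrFun h1 a
  simp only [Matrix.mulVec, dotProduct, Fin.sum_univ_two] at h2
  rw [h2, integral_law (f := fun x => D.zvec B x a * (x.1 * D.weight x))
    ((measurable_zvec hB a).mul (measurable_fst.mul measurable_weight))]
  exact sub_self _

theorem exists_secondMomentZ_ge [IsProbabilityMeasure μ] {ξ : ℝ} (ho : D.Overlap μ ξ)
    (hB : Measurable B) (hB2 : MemLp (fun ω => B (D.V 0 ω)) 2 μ)
    (hdet : (D.secondMomentZ μ B).det ≠ 0) :
    ∃ c : ℝ, 0 < c ∧ ∀ g : Fin 2 → ℝ, 4 * c * (g 0 ^ 2 + g 1 ^ 2)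
      ≤ D.secondMomentZ μ B 0 0 * g 0 ^ 2 + 2 * D.secondMomentZ μ B 0 1 * g 0 * g 1
        + D.secondMomentZ μ B 1 1 * g 1 ^ 2 := by
  have hz := memLp_zvec (D := D) ho hB hB2
  have hi : ∀ a b, Integrable (fun x => D.zvec B x a * D.zvec B x b) (D.law μ) := fun a b =>
    (hz a).integrable_mul (hz b)
  have hsymm : D.secondMomentZ μ B 1 0 = D.secondMomentZ μ B 0 1 := by
    simp only [secondMomentZ_apply hB, mul_comm]
  rw [Matrix.det_fin_two, hsymm] at hdet
  have hadd : ∀ x y : ℝ, Integrable (fun z => D.zvec B z 0 * D.zvec B z 0 * x ^ 2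
      + D.zvec B z 0 * D.zvec B z 1 * (2 * x * y)) (D.law μ) := fun x y =>
    ((hi 0 0).mul_const _).add ((hi 0 1).mul_const _)
  have hnonneg : ∀ x y : ℝ, 0 ≤ D.secondMomentZ μ B 0 0 * x ^ 2
      + 2 * D.secondMomentZ μ B 0 1 * x * y + D.secondMomentZ μ B 1 1 * y ^ 2 := fun x y => by
    have e1 : D.secondMomentZ μ B 0 0 * x ^ 2 + 2 * D.secondMomentZ μ B 0 1 * x * y
        + D.secondMomentZ μ B 1 1 * y ^ 2
        = ∫ z, (D.zvec B z 0 * D.zvec B z 0 * x ^ 2 + D.zvec B z 0 * D.zvec B z 1 * (2 * x * y)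
          + D.zvec B z 1 * D.zvec B z 1 * y ^ 2) ∂D.law μ := by
      rw [integral_add (hadd x y) ((hi 1 1).mul_const _),
        integral_add ((hi 0 0).mul_const _) ((hi 0 1).mul_const _)]
      simp only [integral_mul_const, secondMomentZ_apply hB]
      ring
    rw [e1]
    refine integral_nonneg fun z => ?_
    have : D.zvec B z 0 * D.zvec B z 0 * x ^ 2 + D.zvec B z 0 * D.zvec B z 1 * (2 * x * y)
          + D.zvec B z 1 * D.zvec B z 1 * y ^ 2 = (D.zvec B z 0 * x + D.zvec B z 1 * y) ^ 2 := by
      ring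
    exact this ▸ sq_nonneg _
  obtain ⟨c, hc, h⟩ := exists_quadForm_ge hnonneg hdet
  exact ⟨c, hc, fun g => h _ _⟩

theorem sigmaU_eq (hB : Measurable B) (β : (n : ℕ) → Fin (D.p n) → ℝ) (n : ℕ) :
    D.sigmaU μ B β n = Real.sqrt (∫ x, D.denoisedError μ B β n x ^ 2 ∂D.law μ) := by
  rw [integral_law (f := fun x => D.denoisedError μ B β n x ^ 2)
    ((measurable_denoisedError hB β n).pow_const 2)]
  rfl

/-! ### The nuisance-estimation term is negligible -/

/-- The score `n⁻¹ X'y`. -/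
def score (D : Setup Ω 𝒱 𝒮) (n : ℕ) (ω : Ω) (y : Fin n → ℝ) : Fin (D.p n) → ℝ :=
  (1 / (n : ℝ)) • ((D.Xmat n ω)ᵀ *ᵥ y)

/-- Markov's inequality for a score of a centered function of the observations. -/
theorem BoundedRegressors.measure_score_le [IsProbabilityMeasure μ] {C : ℝ}
    (hb : D.BoundedRegressors μ C) (hs : D.RandomSample μ) {n : ℕ} (hn : 0 < n)
    {G : ℝ × ℝ × 𝒱 → ℝ} (hG : MemLp G 2 (D.law μ))
    (h0 : ∀ j, ∫ x, D.φ n x.2.2 j * G x ∂D.law μ = 0) {m : ℝ} (hm : 0 < m) :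
    μ {ω | m * D.rate n ≤ ‖D.score n ω fun i => G (D.obs i ω)‖}
      ≤ ENNReal.ofReal (Real.sqrt 8 * C * Real.sqrt (∫ x, G x ^ 2 ∂D.law μ) / m) := by
  obtain ⟨hi, hle⟩ := hb.integral_norm_score_le hs hn hG h0
  have hr := rate_pos (D := D) hn
  have h1 := mul_meas_ge_le_integral_of_nonneg (ae_of_all _ fun ω => norm_nonneg _) hi
    (m * D.rate n)
  rw [← ofReal_measureReal]
  refine ENNReal.ofReal_le_ofReal ?_
  rw [le_div_iff₀ hm]
  refine le_of_mul_le_mul_right ?_ hr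
  calc _ = m * D.rate n * μ.real {ω | m * D.rate n
          ≤ ‖D.score n ω fun i => G (D.obs i ω)‖} := by ring
    _ ≤ _ := h1.trans hle

theorem measurable_score_nuisanceError (hB : Measurable B) (n : ℕ) :
    Measurable fun ω => D.score n ω (D.nuisanceError B n ω) := by
  simp only [score, transpose_mulVec_eq_sum]
  refine (Finset.measurable_fun_sum _ fun i _ =>
    (measurable_nuisanceError hB n i).smul ?_).const_smul (1 / (n : ℝ))
  exact (D.measurable_φ n).comp (D.measurable_V i)

theorem tendsto_nuisanceMSE (hL2 : D.L2Convergence μ B) (k : Fin D.K) :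
    Tendsto (fun n => D.nuisanceMSE μ B n k) atTop (𝓝 0) :=
  hL2.2.2 k

theorem tendsto_measure_nuisanceError_sq [IsProbabilityMeasure μ] {ξ : ℝ}
    (hs : D.RandomSample μ) (ho : D.Overlap μ ξ) (hL2 : D.L2Convergence μ B) {t : ℝ}
    (ht : 0 < t) :
    Tendsto (fun n : ℕ => μ {ω | t ≤ 1 / (n : ℝ) * ∑ i, D.nuisanceError B n ω i ^ 2})
      atTop (𝓝 0) := by
  have ht' : ENNReal.ofReal t ≠ 0 := (ENNReal.ofReal_pos.mpr ht).ne'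
  have h1 : Tendsto (fun n => ENNReal.ofReal ((ξ ^ 2)⁻¹ ^ 2) * (∑ k, D.nuisanceMSE μ B n k)
      / ENNReal.ofReal t) atTop (𝓝 0) := by
    have h2 := tendsto_finsetSum (Finset.univ : Finset (Fin D.K))
      fun k _ => tendsto_nuisanceMSE hL2 k
    rw [Finset.sum_const_zero] at h2
    have h3 := ENNReal.Tendsto.div_const (ENNReal.Tendsto.const_mul h2
      (Or.inr (ENNReal.ofReal_ne_top (r := (ξ ^ 2)⁻¹ ^ 2)))) (Or.inr ht')
    simpa using h3
  refine tendsto_of_tendsto_of_tendsto_of_le_of_le' tendsto_const_nhds h1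
    (Eventually.of_forall fun n => zero_le) ?_
  filter_upwards [eventually_gt_atTop 0] with n hn
  have hm : Measurable fun ω => ENNReal.ofReal (1 / (n : ℝ) * ∑ i, D.nuisanceError B n ω i ^ 2) :=
    ((Finset.measurable_fun_sum _ fun i _ =>
      (measurable_nuisanceError hL2.1 n i).pow_const 2).const_mul _).ennreal_ofReal
  refine (measure_mono fun ω hω => ENNReal.ofReal_le_ofReal hω).trans
    ((meas_ge_le_lintegral_div hm.aemeasurable ht' ENNReal.ofReal_ne_top).trans ?_)
  exact ENNReal.div_le_div_right (hs.lintegral_avg_nuisanceError_sq_le ho hL2.1 hn) _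

theorem tendsto_measure_score_nuisanceError [IsProbabilityMeasure μ] {ξ C : ℝ}
    (hs : D.RandomSample μ) (ho : D.Overlap μ ξ) (hb : D.BoundedRegressors μ C)
    (hL2 : D.L2Convergence μ B) {t : ℝ} (ht : 0 < t) :
    Tendsto (fun n : ℕ => μ {ω | t * D.rate n ≤ ‖D.score n ω (D.nuisanceError B n ω)‖})
      atTop (𝓝 0) := by
  have h1 : Tendsto (fun n => ENNReal.ofReal (Real.sqrt 8 * C * (ξ ^ 2)⁻¹ / t)
      * ∑ k, D.nuisanceMSE μ B n k ^ (1 / 2 : ℝ)) atTop (𝓝 0) := by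
    have h2 := tendsto_finsetSum (Finset.univ : Finset (Fin D.K))
      fun k _ => (tendsto_nuisanceMSE hL2 k).ennrpow_const (1 / 2 : ℝ)
    rw [ENNReal.zero_rpow_of_pos (by norm_num), Finset.sum_const_zero] at h2
    simpa using ENNReal.Tendsto.const_mul h2
      (Or.inr (ENNReal.ofReal_ne_top (r := Real.sqrt 8 * C * (ξ ^ 2)⁻¹ / t)))
  refine tendsto_of_tendsto_of_tendsto_of_le_of_le' tendsto_const_nhds h1
    (Eventually.of_forall fun n => zero_le) ?_
  filter_upwards [eventually_gt_atTop 0] with n hn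
  have hr := rate_pos (D := D) hn
  have htr : 0 < t * D.rate n := mul_pos ht hr
  refine (measure_mono (t := {ω | ENNReal.ofReal (t * D.rate n)
    ≤ ‖D.score n ω (D.nuisanceError B n ω)‖ₑ}) fun ω hω => ?_).trans
    ((meas_ge_le_lintegral_div (measurable_score_nuisanceError hL2.1 n).enorm.aemeasurable
      (ENNReal.ofReal_pos.mpr htr).ne' ENNReal.ofReal_ne_top).trans ?_)
  · rw [Set.mem_ofPred_eq, ← ofReal_norm]
    exact ENNReal.ofReal_le_ofReal hω
  · refine (ENNReal.div_le_div_right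
      (hs.lintegral_norm_score_nuisanceError_le ho hb hL2.1 hn) _).trans_eq ?_
    have e1 : Real.sqrt 8 * C * (ξ ^ 2)⁻¹ * D.rate n
        = Real.sqrt 8 * C * (ξ ^ 2)⁻¹ / t * (t * D.rate n) := by field_simp
    have hpos : 0 ≤ Real.sqrt 8 * C * (ξ ^ 2)⁻¹ / t := by have := hb.1; positivity
    rw [e1, ENNReal.ofReal_mul hpos, mul_right_comm, ENNReal.mul_div_cancel_right
      (ENNReal.ofReal_pos.mpr htr).ne' ENNReal.ofReal_ne_top]


/-- The empirical mean of a function of one observation. -/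
def avg (D : Setup Ω 𝒱 𝒮) (n : ℕ) (ω : Ω) (f : ℝ × ℝ × 𝒱 → ℝ) : ℝ :=
  1 / (n : ℝ) * ∑ i : Fin n, f (D.obs i ω)

theorem norm_remainder_lt {n : ℕ} {ω : Ω} {c t a m ε : ℝ} (hn : 0 < n) (hc : 0 < c) (ht : 0 ≤ t)
    (ht1 : t ≤ 1) (htc : t ^ 2 ≤ c / 2) (ha : 0 ≤ a)
    (hε : t * (|D.gam μ B 1| + (m + 1) * (8 * (|D.gam μ B 1| * (a + 1) + 1 + a) / (2 * c))) < ε)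
    (hS : ∀ g : Fin 2 → ℝ, 4 * c * (g 0 ^ 2 + g 1 ^ 2)
      ≤ D.secondMomentZ μ B 0 0 * g 0 ^ 2 + 2 * D.secondMomentZ μ B 0 1 * g 0 * g 1
        + D.secondMomentZ μ B 1 1 * g 1 ^ 2)
    (hSa : ∀ b, D.secondMomentZ μ B b b + c ≤ a ^ 2)
    (hZ : ∀ b b', |D.avg n ω (fun x => D.zvec B x b * D.zvec B x b')
      - D.secondMomentZ μ B b b'| ≤ c)
    (hy : D.avg n ω (fun x => D.ystar μ B x ^ 2) ≤ a ^ 2)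
    (hZy : ∀ b, |D.avg n ω (fun x => D.zvec B x b * D.ystar μ B x)| ≤ t)
    (hXZ : ∀ b, ‖D.score n ω fun i => D.zvec B (D.obs i ω) b‖ ≤ m * D.rate n)
    (hδ : 1 / (n : ℝ) * ∑ i, D.nuisanceError B n ω i ^ 2 ≤ t ^ 2)
    (hXδ : ‖D.score n ω (D.nuisanceError B n ω)‖ ≤ t * D.rate n) :
    ‖D.remainder μ B n ω‖ < ε * D.rate n := by
  refine lt_of_le_of_lt (norm_remainder_le (A' := D.Zhat n ω) (c := 2 * c) (t := t) (a := a)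
    (m := m) (δ := D.nuisanceError B n ω) (by positivity) ht ht1 (by linarith) ha
    (rate_pos hn).le (fun i => rfl) (fun i => ?_)
    (quadForm_ge hS hZ) (fun b => ?_) hy hδ hZy hXZ hXδ)
    (mul_lt_mul_of_pos_right hε (rate_pos hn))
  · simp only [Zhat, Zmat, Z, nuisanceError, Matrix.of_apply, Matrix.cons_val_one,
      Matrix.cons_val_fin_one]
    ring
  · have h1 := (abs_le.mp (hZ b b)).2
    have h2 : 1 / (n : ℝ) * ∑ i, D.Zmat B n ω i b ^ 2
        = D.avg n ω (fun x => D.zvec B x b * D.zvec B x b) := by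
      simp only [avg, ← sq]
      rfl
    rw [h2]
    linarith [hSa b]

/-- The nuisance-estimation term is of smaller order than the rate: no rate of convergence of the
nuisance estimates is needed, since their error enters only through its score, which is centered
given the other folds, and through a product with scores of the order of the rate. -/
theorem tendsto_measure_remainder [IsProbabilityMeasure μ] {β : (n : ℕ) → Fin (D.p n) → ℝ}
    {ξ C : ℝ} (hs : D.RandomSample μ) (ho : D.Overlap μ ξ) (hb : D.BoundedRegressors μ C)
    (hL2 : D.L2Convergence μ B) (hdet : (D.secondMomentZ μ B).det ≠ 0)
    (hmoment : ∀ n, MemLp (D.e β n 0) 2 μ) {ε : ℝ} (hε : 0 < ε) :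
    Tendsto (fun n => μ {ω | ε * D.rate n ≤ ‖D.remainder μ B n ω‖}) atTop (𝓝 0) := by
  have hB := hL2.1
  have hz := memLp_zvec (D := D) ho hB hL2.2.1
  have hys := memLp_ystar (D := D) ho hb hB hL2.2.1 (hmoment 0)
  obtain ⟨c, hc, hS⟩ := exists_secondMomentZ_ge ho hB hL2.2.1 hdet
  set S := D.secondMomentZ μ B with hSdef
  have hSnonneg : ∀ b, 0 ≤ S b b := fun b => by
    rw [hSdef, secondMomentZ_apply hB]
    exact integral_nonneg fun x => mul_self_nonneg _
  set vy := ∫ x, D.ystar μ B x ^ 2 ∂D.law μ with hvy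
  have hvy0 : 0 ≤ vy := integral_nonneg fun x => sq_nonneg _
  set a := Real.sqrt (S 0 0 + S 1 1 + vy + c) with ha
  have ha2 : a ^ 2 = S 0 0 + S 1 1 + vy + c :=
    Real.sq_sqrt (by linarith [hSnonneg 0, hSnonneg 1])
  rw [ENNReal.tendsto_nhds_zero]
  intro ρ hρ
  -- The level `m` is exceeded by the scores of the columns of `Z` with small probability only.
  obtain ⟨m, hm, hmρ⟩ : ∃ m : ℝ, 0 < m ∧ ∑ b : Fin 2, ENNReal.ofReal
      (Real.sqrt 8 * C * Real.sqrt (∫ x, D.zvec B x b ^ 2 ∂D.law μ) / m) ≤ ρ / 2 := by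
    have h1 : Tendsto (fun m : ℝ => ∑ b : Fin 2, ENNReal.ofReal
        (Real.sqrt 8 * C * Real.sqrt (∫ x, D.zvec B x b ^ 2 ∂D.law μ) / m)) atTop (𝓝 0) := by
      have h2 := tendsto_finsetSum (Finset.univ : Finset (Fin 2)) fun b _ =>
        ENNReal.tendsto_ofReal ((tendsto_const_nhds (x := Real.sqrt 8 * C
          * Real.sqrt (∫ x, D.zvec B x b ^ 2 ∂D.law μ))).div_atTop tendsto_id)
      simpa using h2
    obtain ⟨m, h2, h3⟩ := ((ENNReal.tendsto_nhds_zero.mp h1 (ρ / 2)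
      (ENNReal.half_pos hρ.ne')).and (eventually_gt_atTop 0)).exists
    exact ⟨m, h3, h2⟩
  set q := |D.gam μ B 1| + (m + 1) * (8 * (|D.gam μ B 1| * (a + 1) + 1 + a) / (2 * c)) with hq
  have ha0 : 0 ≤ a := Real.sqrt_nonneg _
  have hq0 : 0 ≤ q := by positivity
  obtain ⟨t, ht, ht1, htc, htε⟩ : ∃ t : ℝ, 0 < t ∧ t ≤ 1 ∧ t ^ 2 ≤ c / 2 ∧ t * q < ε := by
    refine ⟨min 1 (min (c / 2) (ε / (q + 1))), by positivity, min_le_left _ _, ?_, ?_⟩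
    · set t := min 1 (min (c / 2) (ε / (q + 1)))
      have h1 : t ≤ 1 := min_le_left _ _
      have h2 : t ≤ c / 2 := (min_le_right _ _).trans (min_le_left _ _)
      have h3 : 0 ≤ t := by positivity
      nlinarith
    · calc _ ≤ ε / (q + 1) * q := mul_le_mul_of_nonneg_right
            ((min_le_right _ _).trans (min_le_right _ _)) hq0
        _ < ε := by
          rw [div_mul_eq_mul_div, div_lt_iff₀ (by positivity)]
          nlinarith
  -- The remaining exceptional events have probabilities that tend to zero.
  have hlim : Tendsto (fun n : ℕ =>
      ∑ b : Fin 2, ∑ b' : Fin 2, μ {ω | c ≤ |D.avg n ω (fun x => D.zvec B x b * D.zvec B x b')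
          - S b b'|}
      + μ {ω | c ≤ |D.avg n ω (fun x => D.ystar μ B x ^ 2) - vy|}
      + ∑ b : Fin 2, μ {ω | t ≤ |D.avg n ω (fun x => D.zvec B x b * D.ystar μ B x)|}
      + μ {ω | t ^ 2 ≤ 1 / (n : ℝ) * ∑ i, D.nuisanceError B n ω i ^ 2}
      + μ {ω | t * D.rate n ≤ ‖D.score n ω (D.nuisanceError B n ω)‖}) atTop (𝓝 0) := by
    have h1 : ∀ b b', Tendsto (fun n : ℕ => μ {ω | c ≤ |D.avg n ω (fun x => D.zvec B x b
        * D.zvec B x b') - S b b'|}) atTop (𝓝 0) := fun b b' => by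
      rw [hSdef, secondMomentZ_apply hB]
      exact hs.tendsto_measure_avg ((measurable_zvec hB b).mul (measurable_zvec hB b'))
        ((hz b).integrable_mul (hz b')) hc
    have h2 : Tendsto (fun n : ℕ => μ {ω | c ≤ |D.avg n ω (fun x => D.ystar μ B x ^ 2) - vy|})
        atTop (𝓝 0) :=
      hs.tendsto_measure_avg ((measurable_ystar hB).pow_const 2) hys.integrable_sq hc
    have h3 : ∀ b, Tendsto (fun n : ℕ => μ {ω | t ≤ |D.avg n ω (fun x => D.zvec B x b
        * D.ystar μ B x)|}) atTop (𝓝 0) := fun b => by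
      have := hs.tendsto_measure_avg (f := fun x => D.zvec B x b * D.ystar μ B x)
        ((measurable_zvec hB b).mul (measurable_ystar hB))
        ((hz b).integrable_mul hys) ht
      rw [integral_zvec_mul_ystar ho hb hB hL2.2.1 (hmoment 0) hdet b] at this
      simp only [sub_zero] at this
      exact this
    have h4 := tendsto_measure_nuisanceError_sq hs ho hL2 (pow_pos ht 2)
    have h5 := tendsto_measure_score_nuisanceError hs ho hb hL2 ht
    have h6 := ((((tendsto_finsetSum Finset.univ fun b _ =>
      tendsto_finsetSum Finset.univ fun b' _ => h1 b b').add h2).add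
      (tendsto_finsetSum Finset.univ fun b _ => h3 b)).add h4).add h5
    simpa using h6
  filter_upwards [ENNReal.tendsto_nhds_zero.mp hlim (ρ / 2) (ENNReal.half_pos hρ.ne'),
    eventually_gt_atTop 0] with n hsmall hn
  have hsub : {ω | ε * D.rate n ≤ ‖D.remainder μ B n ω‖} ⊆
      ((((⋃ b : Fin 2, ⋃ b' : Fin 2,
        {ω | c ≤ |D.avg n ω (fun x => D.zvec B x b * D.zvec B x b') - S b b'|})
      ∪ {ω | c ≤ |D.avg n ω (fun x => D.ystar μ B x ^ 2) - vy|})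
      ∪ ⋃ b : Fin 2, {ω | t ≤ |D.avg n ω (fun x => D.zvec B x b * D.ystar μ B x)|})
      ∪ {ω | t ^ 2 ≤ 1 / (n : ℝ) * ∑ i, D.nuisanceError B n ω i ^ 2})
      ∪ {ω | t * D.rate n ≤ ‖D.score n ω (D.nuisanceError B n ω)‖}
      ∪ ⋃ b : Fin 2, {ω | m * D.rate n ≤ ‖D.score n ω fun i => D.zvec B (D.obs i ω) b‖} := by
    intro ω hω
    by_contra hcon
    simp only [Set.mem_union, Set.mem_iUnion, Set.mem_ofPred_eq, not_or, not_exists,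
      not_le] at hcon
    obtain ⟨⟨⟨⟨⟨g1, g2⟩, g3⟩, g4⟩, g5⟩, g6⟩ := hcon
    refine absurd hω (not_le.mpr (norm_remainder_lt hn hc ht.le ht1 htc ha0 htε hS ?_
      (fun b b' => (g1 b b').le) ?_ (fun b => (g3 b).le) (fun b => (g6 b).le) g4.le g5.le))
    · rw [ha2, Fin.forall_fin_two]
      constructor <;> linarith [hSnonneg 0, hSnonneg 1]
    · rw [ha2]
      linarith [(abs_lt.mp g2).2, hSnonneg 0, hSnonneg 1]
  have hscore : ∑ b : Fin 2, μ {ω | m * D.rate n ≤ ‖D.score n ω fun i => D.zvec B (D.obs i ω) b‖}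
      ≤ ρ / 2 :=
    (Finset.sum_le_sum fun b _ => hb.measure_score_le hs hn (hz b)
      (fun j => integral_regressor_mul_zvec ho hb hB hL2.2.1 n j b) hm).trans hmρ
  calc _ ≤ _ := measure_mono hsub
    _ ≤ ρ / 2 + ρ / 2 := by
      refine (measure_union_le _ _).trans (add_le_add (le_trans ?_ hsmall)
        ((measure_iUnion_fintype_le _ _).trans hscore))
      refine (measure_union_le _ _).trans (add_le_add ?_ le_rfl)
      refine (measure_union_le _ _).trans (add_le_add ?_ le_rfl)
      refine (measure_union_le _ _).trans (add_le_add ?_ (measure_iUnion_fintype_le _ _))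
      refine (measure_union_le _ _).trans (add_le_add ?_ le_rfl)
      exact (measure_iUnion_fintype_le _ _).trans
        (Finset.sum_le_sum fun b _ => measure_iUnion_fintype_le _ _)
    _ = ρ := ENNReal.add_halves ρ

/-! ### The prediction bound -/

/-- With probability at least `1 - η` the score of the denoised error is at most `η⁻¹` times the
bound of its mean. -/
theorem measure_lt_score_denoisedError_le [IsProbabilityMeasure μ]
    {β : (n : ℕ) → Fin (D.p n) → ℝ} {ξ C : ℝ} (hs : D.RandomSample μ) (hmodel : D.LinearModel μ β)
    (ho : D.Overlap μ ξ) (hb : D.BoundedRegressors μ C) (hB : Measurable B)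
    (hB2 : MemLp (fun ω => B (D.V 0 ω)) 2 μ) {n : ℕ} (hn : 0 < n) (he : MemLp (D.e β n 0) 2 μ)
    {η : ℝ} (hη : 0 < η) :
    μ.real {ω | Real.sqrt 8 * C * D.sigmaU μ B β n / η * D.rate n
      < ‖D.score n ω fun i => D.u μ B β n i ω‖} ≤ η := by
  have hu := memLp_denoisedError (D := D) ho hB hB2 he
  have h0 := fun j => integral_regressor_mul_denoisedError (D := D) ho hb hB hB2 hmodel he j
  have hσ : 0 ≤ D.sigmaU μ B β n := Real.sqrt_nonneg _
  rcases hσ.eq_or_lt with hzero | hpos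
  · -- Markov's inequality gives nothing at the level zero, but here the score vanishes a.s.
    obtain ⟨hi, hle⟩ := hb.integral_norm_score_le hs hn hu h0
    rw [← sigmaU_eq hB, ← hzero, mul_zero, zero_mul] at hle
    have h1 := (integral_eq_zero_iff_of_nonneg (fun ω => norm_nonneg _) hi).mp
      (le_antisymm hle (integral_nonneg fun ω => norm_nonneg _))
    have h2 : μ {ω | Real.sqrt 8 * C * D.sigmaU μ B β n / η * D.rate n
        < ‖D.score n ω fun i => D.u μ B β n i ω‖} = 0 := by
      rw [← hzero, mul_zero, zero_div, zero_mul]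
      refine measure_mono_null (fun ω hω => ?_) (ae_iff.mp h1)
      exact (show 0 < ‖D.score n ω fun i => D.u μ B β n i ω‖ from hω).ne'
    rw [measureReal_def, h2, ENNReal.toReal_zero]
    exact hη.le
  · have hC := hb.1
    have hm : 0 < Real.sqrt 8 * C * D.sigmaU μ B β n / η := by positivity
    have h1 := hb.measure_score_le hs hn hu h0 hm
    rw [← sigmaU_eq hB, div_div_cancel₀ (by positivity)] at h1
    refine ENNReal.toReal_le_of_le_ofReal hη.le ((measure_mono fun ω hω => ?_).trans h1)
    exact (show _ < ‖D.score n ω fun i => D.u μ B β n i ω‖ from hω).le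

/-- The residual of the regression on `Ẑ` is `Xβ + u` up to the nuisance-estimation term. -/
theorem IsDIPWLasso.prediction_le {n : ℕ} (hn : 0 < n) {ω : Ω} {lam s r : ℝ}
    {β : (n : ℕ) → Fin (D.p n) → ℝ} {b : Fin (D.p n) → ℝ} (h : D.IsDIPWLasso n ω lam b)
    (hu : ‖D.score n ω fun i => D.u μ B β n i ω‖ ≤ s) (hr : ‖D.remainder μ B n ω‖ ≤ r)
    (hlam : s + r ≤ lam) :
    1 / (n : ℝ) * ∑ i, ((D.Xmat n ω *ᵥ b) i - (D.Xmat n ω *ᵥ β n) i) ^ 2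
      ≤ 4 * lam * ∑ j, |β n j| := by
  obtain ⟨g, hg, hb⟩ := h
  set Zg := D.Zmat B n ω *ᵥ D.gam μ B with hZg
  set u : Fin n → ℝ := fun i => D.u μ B β n i ω with hudef
  set y : Fin n → ℝ := fun i => D.Ystar μ B i ω with hy
  have e1 : D.YWvec n ω = Zg + y := by
    ext i
    simp only [hZg, hy, YWvec, Ystar, Pi.add_apply]
    exact (add_sub_cancel _ _).symm
  have e2 : y = D.Xmat n ω *ᵥ β n + u := by
    ext i
    simp only [hudef, hy, Setup.u, e, Ystar, Pi.add_apply]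
    have : (D.Xmat n ω *ᵥ β n) i = D.φ n (D.V i ω) ⬝ᵥ β n := rfl
    rw [this]
    ring
  have e3 : D.YWvec n ω - D.Zhat n ω *ᵥ g = D.Xmat n ω *ᵥ β n
      + (u + (Zg - colProj (D.Zhat n ω) Zg - colProj (D.Zhat n ω) y)) := by
    rw [hg.mulVec_eq, e1, colProj_add]
    nth_rewrite 1 [e2]
    abel
  rw [e3] at hb
  refine hb.prediction_le hn ?_
  have e4 : (1 / (n : ℝ)) • ((D.Xmat n ω)ᵀ *ᵥ
      (u + (Zg - colProj (D.Zhat n ω) Zg - colProj (D.Zhat n ω) y)))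
      = D.score n ω u + D.remainder μ B n ω := by
    rw [Matrix.mulVec_add, Matrix.mulVec_sub, smul_add, smul_sub, score, remainder]
  rw [e4]
  exact (norm_add_le _ _).trans ((add_le_add hu hr).trans hlam)

end Setup

end DIPW

end

theorem theorem1 {Ω 𝒱 𝒮 : Type*} [MeasurableSpace Ω] [MeasurableSpace 𝒱] [MeasurableSpace 𝒮]
    (μ : Measure Ω) [IsProbabilityMeasure μ] (D : DIPW.Setup Ω 𝒱 𝒮)
    (β : (n : ℕ) → Fin (D.p n) → ℝ) (B : 𝒱 → ℝ) (ξ C : ℝ)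
    (hsample : D.RandomSample μ)
    (hmodel : D.LinearModel μ β)
    (hoverlap : D.Overlap μ ξ)
    (hbounded : D.BoundedRegressors μ C)
    (hmoment : ∀ n, MemLp (D.e β n 0) 2 μ)
    (hL2 : D.L2Convergence μ B)
    (hdet : (D.secondMomentZ μ B).det ≠ 0)
    (η : ℝ) (hη0 : 0 < η) (hη1 : η < 1) (ε : ℝ) (hε : 0 < ε) :
    (∀ n : ℕ, 0 < n → ∀ lam : ℝ,
      (Real.sqrt 8 * C * D.sigmaU μ B β n / η + ε) * D.rate n ≤ lam →
      ∃ A : Set Ω, MeasurableSet A ∧ 1 - η - D.delta μ B ε n ≤ μ.real A ∧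
        ∀ ω ∈ A, ∀ b : Fin (D.p n) → ℝ, D.IsDIPWLasso n ω lam b →
          1 / (n : ℝ) * ∑ i, ((D.Xmat n ω *ᵥ b) i - (D.Xmat n ω *ᵥ β n) i) ^ 2
            ≤ 4 * lam * ∑ j, |β n j|) ∧
    Tendsto (fun n => D.delta μ B ε n) atTop (𝓝 0) ∧
    (∀ n : ℕ, 0 < n → D.sigmaU μ B β n < D.sigmaE μ β n →
      ∃ ε₀ : ℝ, 0 < ε₀ ∧ ∀ ε' : ℝ, 0 < ε' → ε' < ε₀ →
        (Real.sqrt 8 * C * D.sigmaU μ B β n / η + ε') * D.rate n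
          < Real.sqrt 8 * C * D.sigmaE μ β n / η * D.rate n) := by
  refine ⟨fun n hn lam hlam => ?_, ?_, fun n hn hσ => ?_⟩
  · set E₁ := {ω | Real.sqrt 8 * C * D.sigmaU μ B β n / η * D.rate n
      < ‖D.score n ω fun i => D.u μ B β n i ω‖} with hE₁
    set E₂ := {ω | ε * D.rate n ≤ ‖D.remainder μ B n ω‖} with hE₂
    -- The measurable hull makes the measurability of the projection irrelevant.
    refine ⟨(toMeasurable μ (E₁ ∪ E₂))ᶜ, (measurableSet_toMeasurable _ _).compl, ?_, ?_⟩
    · rw [probReal_compl_eq_one_sub (measurableSet_toMeasurable _ _), measureReal_def,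
        measure_toMeasurable, ← measureReal_def]
      have h1 := measureReal_union_le (μ := μ) E₁ E₂
      have h2 := DIPW.Setup.measure_lt_score_denoisedError_le hsample hmodel hoverlap hbounded
        hL2.1 hL2.2.1 hn (hmoment n) hη0
      have h3 : D.delta μ B ε n = μ.real E₂ := rfl
      linarith
    · intro ω hω b hb
      have h1 : ω ∉ E₁ ∪ E₂ := fun h => hω (subset_toMeasurable _ _ h)
      rw [Set.mem_union, not_or] at h1
      exact hb.prediction_le (μ := μ) (B := B) hn (not_lt.mp h1.1) (not_le.mp h1.2).le
        (by rw [← add_mul]; exact hlam)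
  · have h := DIPW.Setup.tendsto_measure_remainder hsample hoverlap hbounded hL2 hdet hmoment hε
    have h2 := (ENNReal.tendsto_toReal ENNReal.zero_ne_top).comp h
    rwa [ENNReal.toReal_zero] at h2
  · have hC := hbounded.1
    refine ⟨Real.sqrt 8 * C * (D.sigmaE μ β n - D.sigmaU μ B β n) / η,
      div_pos (mul_pos (by positivity) (sub_pos.mpr hσ)) hη0, fun ε' _ hε' =>
      mul_lt_mul_of_pos_right ?_ (DIPW.Setup.rate_pos hn)⟩
    have : Real.sqrt 8 * C * D.sigmaE μ β n / η = Real.sqrt 8 * C * D.sigmaU μ B β n / η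
        + Real.sqrt 8 * C * (D.sigmaE μ β n - D.sigmaU μ B β n) / η := by ring
    linarith
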